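/- For integers $n,m\ge1$ let $\zeta_n=e^{2\pi i/n}$, let $c_n(m)=\sum_{1\le k\le n,\ (k,n)=1}\zeta_n^{km}$ be the Ramanujan sum, let $\Phi_n$ be the $n$-th cyclotomic polynomial and $\hat\Phi_n(z)=\prod_{1\le k\le n,\ (k,n)=1}(1-z\zeta_n^{k})$, so that $\hat\Phi_1(z)=1-z$ and $\hat\Phi_n=\Phi_n$ for $n\ge2$. For $|z|<1$ let $\log\hat\Phi_n(z)=\sum_{1\le k\le n,\ (k,n)=1}\log(1-z\zeta_n^k)$ with principal logarithms; this is the branch that is holomorphic on the unit disk and vanishes at $z=0$. Put $\hat\Phi_n(z)^a=\exp(a\log\hat\Phi_n(z))$, and use principal logarithms and powers of $1-z^n$. Let $r_2(n)$ be the number of pairs $(a,b)\in\mathbb Z^2$ with $a^2+b^2=n$, and let $\theta(z)=\sum_{n\in\mathbb Z}z^{n^2}$. Infinite products and series indexed by $i\ge 0$ are limits of their partial products and sums over $0\le i<N$ as $N\to\infty$. Then: 1. (Ramanujan's formula) For every $n\ge1$, the following series converges and $$\pi\sum_{i=0}^\infty(-1)^i\frac{c_{2i+1}(n)}{2i+1}=r_2(n).$$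 2. For $|z|<1$ both of the following infinite products converge, to the same nonzero limit $P(z)$: $$\prod_{i=0}^{\infty}\frac{(1-z^{4i+3})^{4/(4i+3)}}{(1-z^{4i+1})^{4/(4i+1)}}=\prod_{i=0}^{\infty}\frac{\Phi_{4i+3}(z)^{\pi/(4i+3)}}{\hat\Phi_{4i+1}(z)^{\pi/(4i+1)}}.$$ 3. $P$ is holomorphic on $|z|<1$, and there $$z\frac{P'(z)}{P(z)}=\sum_{n=1}^\infty r_2(n)z^n,\qquad 1+z\frac{P'(z)}{P(z)}=\theta(z)^2 .$$ With $z=e^{2\pi i\tau}$, $\operatorname{Im}\tau>0$, the function $F(\tau)=1+zP'(z)/P(z)$ is a holomorphic modular form (including holomorphy at the cusps) of weight $1$ on $\Gamma_0(4)$ with the nontrivial Dirichlet character $\chi_{-4}$ modulo $4$; that is, $F$ is a modular form of weight $1$ on $\Gamma_1(4)$ and $F\left(\frac{a\tau+b}{c\tau+d}\right)=\chi_{-4}(d)(c\tau+d)F(\tau)$ for all $\begin{pmatrix}a&b\\c&d\end{pmatrix}\in\Gamma_0(4)$. 4. For $|z|<1$ both of the following series converge and $$\sum_{i\ge0}\left[\frac{4\log(1-z^{4i+3})}{4i+3}-\frac{4\log(1-z^{4i+1})}{4i+1}\right]=\sum_{i\ge0}\left[\frac{\pi\log\Phi_{4i+3}(z)}{4i+3}-\frac{\pi\log\hat\Phi_{4i+1}(z)}{4i+1}\right].$$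 5. For $|z|<1$ the series $$A(z)=\sum_{i\ge0}(-1)^{i+1}\frac{\log(1-z^{2i+1})}{2i+1},\qquad B(z)=\sum_{i\ge0}(-1)^{i+1}\frac{\log\hat\Phi_{2i+1}(z)}{2i+1}$$ converge and $A(z)=\frac{\pi}{4}B(z)$. The zeros of $B$ have no accumulation point in the unit disk, and at every other point of the disk $$\frac{\pi}{4}=\frac{A(z)}{B(z)}.$$ -/

import Mathlib

open scoped BigOperators Topology Real UpperHalfPlane

namespace CycProd

noncomputable section

/-- The indices `k` with `1 ≤ k ≤ n` and `gcd(k,n) = 1`. -/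
def units (n : ℕ) : Finset ℕ := (Finset.Icc 1 n).filter (fun k => Nat.gcd k n = 1)

/-- `ζ_n^k = e^{2πik/n}`. -/
def zetaPow (n k : ℕ) : ℂ := Complex.exp (2 * π * Complex.I * k / n)

/-- The Ramanujan sum `c_n(m) = ∑_{1 ≤ k ≤ n, (k,n)=1} e^{2πikm/n}`. -/
def ramanujanSum (n m : ℕ) : ℂ := ∑ k ∈ units n, Complex.exp (2 * π * Complex.I * k * m / n)

/-- `r_2(n)`, the number of pairs of integers `(a,b)` with `a² + b² = n`. -/
def r2 (n : ℕ) : ℕ := Nat.card {p : ℤ × ℤ // p.1 ^ 2 + p.2 ^ 2 = (n : ℤ)}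

/-- `Φ̂_n(z) = ∏_{1 ≤ k ≤ n, (k,n)=1} (1 - z ζ_n^k)`. -/
def phiHat (n : ℕ) (z : ℂ) : ℂ := ∏ k ∈ units n, (1 - z * zetaPow n k)

/-- `log Φ̂_n(z) = ∑_{1 ≤ k ≤ n, (k,n)=1} log (1 - z ζ_n^k)` on the unit disk, with principal
logarithms of the factors, which lie in the right half plane. This is the branch of the logarithm
of `Φ̂_n` that is holomorphic on the unit disk and vanishes at `0`
(see `isDiskLog_logPhiHat` and `IsDiskLog.unique`). -/
def logPhiHat (n : ℕ) (z : ℂ) : ℂ := ∑ k ∈ units n, Complex.log (1 - z * zetaPow n k)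

/-- The power `Φ̂_n(z)^a` on the unit disk, formed with `logPhiHat`. For `n ≥ 2` this is
`Φ_n(z)^a` (see `phiHat_eq_cyclotomic`). -/
def phiHatPow (n : ℕ) (a : ℂ) (z : ℂ) : ℂ := Complex.exp (a * logPhiHat n z)

/-- The theta function `θ(z) = ∑_{n ∈ ℤ} z^{n²}`. -/
def theta (z : ℂ) : ℂ := ∑' n : ℤ, z ^ (n.natAbs ^ 2)

/-- `ℓ` is the branch of `log f` on the unit disk that is holomorphic and vanishes at `0`. -/
def IsDiskLog (f ℓ : ℂ → ℂ) : Prop :=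
  DifferentiableOn ℂ ℓ (Metric.ball 0 1) ∧ ℓ 0 = 0 ∧
    ∀ z ∈ Metric.ball (0 : ℂ) 1, Complex.exp (ℓ z) = f z

theorem norm_zetaPow (n k : ℕ) : ‖zetaPow n k‖ = 1 := by
  have : (2 * π * Complex.I * k / n : ℂ) = ((2 * π * k / n : ℝ) : ℂ) * Complex.I := by
    push_cast; ring
  rw [zetaPow, this, Complex.norm_exp_ofReal_mul_I]

theorem factor_mem_slitPlane (n k : ℕ) {z : ℂ} (hz : z ∈ Metric.ball (0 : ℂ) 1) :
    1 - z * zetaPow n k ∈ Complex.slitPlane := by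
  have h : ‖z * zetaPow n k‖ < 1 := by
    rw [norm_mul, norm_zetaPow, mul_one]
    simpa using hz
  left
  have := (Complex.re_le_norm (z * zetaPow n k)).trans_lt h
  simp only [Complex.sub_re, Complex.one_re]
  linarith

theorem isDiskLog_logPhiHat (n : ℕ) : IsDiskLog (phiHat n) (logPhiHat n) := by
  refine ⟨?_, by simp [logPhiHat], fun z hz => ?_⟩
  · unfold logPhiHat
    refine DifferentiableOn.fun_sum fun k _ => ?_
    refine DifferentiableOn.clog (by fun_prop) fun z hz => factor_mem_slitPlane n k hz
  · rw [logPhiHat, Complex.exp_sum, phiHat]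
    exact Finset.prod_congr rfl fun k _ =>
      Complex.exp_log (Complex.slitPlane_ne_zero (factor_mem_slitPlane n k hz))

theorem IsDiskLog.unique {f ℓ ℓ' : ℂ → ℂ} (h : IsDiskLog f ℓ) (h' : IsDiskLog f ℓ') :
    Set.EqOn ℓ ℓ' (Metric.ball 0 1) := by
  have hd : ∀ g : ℂ → ℂ, IsDiskLog f g → ∀ z ∈ Metric.ball (0 : ℂ) 1,
      HasDerivAt g (deriv g z) z := fun g hg z hz =>
    (hg.1.differentiableAt (Metric.isOpen_ball.mem_nhds hz)).hasDerivAt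
  refine Metric.isOpen_ball.eqOn_of_deriv_eq
    (convex_ball (0 : ℂ) 1).isPreconnected h.1 h'.1 (fun z hz => ?_)
    (Metric.mem_ball_self one_pos) (h.2.1.trans h'.2.1.symm)
  have e1 := (hd ℓ h z hz).cexp
  have e2 := (hd ℓ' h' z hz).cexp
  have e : (fun w => Complex.exp (ℓ' w)) =ᶠ[𝓝 z] fun w => Complex.exp (ℓ w) := by
    filter_upwards [Metric.isOpen_ball.mem_nhds hz] with w hw
    rw [h.2.2 w hw, h'.2.2 w hw]
  have e3 := e1.unique (e2.congr_of_eventuallyEq e.symm)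
  rw [h.2.2 z hz, ← h'.2.2 z hz] at e3
  exact mul_left_cancel₀ (Complex.exp_ne_zero _) e3

theorem phiHat_eq_cyclotomic {n : ℕ} (hn : 2 ≤ n) (z : ℂ) :
    phiHat n z = (Polynomial.cyclotomic n ℂ).eval z := by
  have hn0 : n ≠ 0 := by omega
  have hroots : ∀ w : ℂ, ∏ k ∈ units n, (w - zetaPow n k) =
      (Polynomial.cyclotomic n ℂ).eval w := by
    intro w
    rw [Polynomial.cyclotomic_eq_prod_X_sub_primitiveRoots (Complex.isPrimitiveRoot_exp n hn0),
      Polynomial.eval_prod]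
    refine Finset.prod_bij (fun k _ => zetaPow n k) ?_ ?_ ?_ (by simp)
    · intro k hk
      simp only [units, Finset.mem_filter] at hk
      rw [mem_primitiveRoots (by omega), zetaPow]
      have := Complex.isPrimitiveRoot_exp_of_coprime k n hn0 hk.2
      rwa [← mul_div_assoc] at this
    · intro k hk l hl hkl
      simp only [units, Finset.mem_filter, Finset.mem_Icc] at hk hl
      have hlt : ∀ j, 1 ≤ j ∧ j ≤ n → Nat.gcd j n = 1 → j < n := by
        intro j hj hg
        rcases lt_or_eq_of_le hj.2 with h | h
        · exact h
        · subst h; simp at hg; omega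
      have hp : ∀ j, zetaPow n j = Complex.exp (2 * π * Complex.I / n) ^ j := by
        intro j; rw [zetaPow, ← Complex.exp_nat_mul]; congr 1; ring
      rw [hp, hp] at hkl
      exact (Complex.isPrimitiveRoot_exp n hn0).pow_inj (hlt k hk.1 hk.2) (hlt l hl.1 hl.2) hkl
    · intro μ hμ
      rw [mem_primitiveRoots (by omega), Complex.isPrimitiveRoot_iff _ _ hn0] at hμ
      obtain ⟨i, hi, hc, rfl⟩ := hμ
      refine ⟨i, ?_, by rw [zetaPow, ← mul_div_assoc]⟩
      simp only [units, Finset.mem_filter, Finset.mem_Icc]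
      refine ⟨⟨?_, hi.le⟩, hc⟩
      rcases Nat.eq_zero_or_pos i with h | h
      · subst h; simp at hc; omega
      · exact h
  have h0 : ∀ k, zetaPow n k ≠ 0 := fun k => Complex.exp_ne_zero _
  -- the product of the primitive roots, up to sign, is the constant coefficient
  have hc0 : ∏ k ∈ units n, (-zetaPow n k) = 1 := by
    have := hroots 0
    simp only [zero_sub] at this
    rw [this, ← Polynomial.coeff_zero_eq_eval_zero, Polynomial.cyclotomic_coeff_zero _ (by omega)]
  -- pair each root with its inverse
  have hinv : ∏ k ∈ units n, (z - zetaPow n k) = ∏ k ∈ units n, (z - (zetaPow n k)⁻¹) := by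
    refine Finset.prod_bij' (fun k _ => n - k) (fun k _ => n - k) ?_ ?_ ?_ ?_ ?_
    · exact fun k hk => units_sub hn hk
    · exact fun k hk => units_sub hn hk
    · intro k hk
      simp only [units, Finset.mem_filter, Finset.mem_Icc] at hk
      omega
    · intro k hk
      simp only [units, Finset.mem_filter, Finset.mem_Icc] at hk
      omega
    · intro k hk
      simp only [units, Finset.mem_filter, Finset.mem_Icc] at hk
      congr 1
      rw [zetaPow, zetaPow, ← Complex.exp_neg, Nat.cast_sub hk.1.2]
      have hnc : (n : ℂ) ≠ 0 := by exact_mod_cast hn0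
      rw [show -(2 * π * Complex.I * ((n : ℂ) - k) / n) =
        2 * π * Complex.I * k / n - 2 * π * Complex.I by field_simp; ring,
        Complex.exp_sub, Complex.exp_two_pi_mul_I, div_one]
  rw [← hroots, hinv, ← one_mul (∏ k ∈ units n, (z - (zetaPow n k)⁻¹)), ← hc0,
    ← Finset.prod_mul_distrib, phiHat]
  refine Finset.prod_congr rfl fun k _ => ?_
  have := h0 k
  field_simp
  ring
where
  units_sub {n k : ℕ} (hn : 2 ≤ n) (hk : k ∈ units n) : n - k ∈ units n := by
    simp only [units, Finset.mem_filter, Finset.mem_Icc] at hk ⊢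
    obtain ⟨⟨h1, h2⟩, hg⟩ := hk
    have hlt : k < n := by
      rcases lt_or_eq_of_le h2 with h | h
      · exact h
      · subst h; simp at hg; omega
    refine ⟨⟨by omega, by omega⟩, ?_⟩
    have : Nat.Coprime (n - k) n := (Nat.coprime_self_sub_left h2).2 hg
    exact this

theorem hasSum_theta {z : ℂ} (hz : z ∈ Metric.ball (0 : ℂ) 1) :
    HasSum (fun n : ℤ => z ^ (n.natAbs ^ 2)) (theta z) := by
  have hz1 : ‖z‖ < 1 := by simpa using hz
  have h : Summable fun n : ℕ => z ^ (n ^ 2) := by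
    refine Summable.of_norm_bounded (summable_geometric_of_lt_one (norm_nonneg z) hz1) fun n => ?_
    rw [norm_pow]
    exact pow_le_pow_of_le_one (norm_nonneg z) hz1.le (Nat.le_self_pow two_ne_zero n)
  exact (Summable.of_nat_of_neg (by simpa using h) (by simpa using h)).hasSum

end

end CycProd

/-! Everything is read off from one power series, S(z) = ∑ r₂(m) z^m / m over m ≥ 1 (`r2LogSeries`).
Expand both families of logarithms in powers of z. For log(1 - z^q), the coefficient of z^m / m in a
partial sum is a truncation of ∑_{d ∣ m} χ₄(d), which is r₂(m)/4 by the two-square theorem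
(`r2_eq_four_mul_chiDivisorSum`). For log Φ̂_q it is a partial sum of Ramanujan's series, with limit
r₂(m)/π (`tendsto_ramanujanPartialSum`). Both are O(m) uniformly in the truncation, so dominated
convergence (`tendsto_of_hasSum_mul_pow_div`) gives the limits S/4 and S/π. Hence P = exp S, and the
ratio of the two limits is π/4.

Ramanujan's formula is the deep point. Writing c_q(n) as a sum over common divisors of q and n turns
its partial sums into finite combinations of partial sums of ∑ χ₄(k) μ(k)/k
(`sum_chi4_ramanujanSum`). That this series converges, to 1/L(1,χ₄) = 4/π, has the strength of the
prime number theorem in progressions modulo 4. It follows from the nonvanishing of L(s,χ₄) on Re s ≥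
1 through a Tauberian theorem (`tendsto_of_laplace_continuousOn`): smooth with a band-limited
kernel, move to the boundary line, apply Riemann–Lebesgue, and remove the smoothing by slow
oscillation.

Termwise differentiation gives 1 + zS'(z) = θ(z)². The inversion formula of the Jacobi theta
function yields the behaviour of θ² under (1, 0; 4, 1), which with T and -1 generates Γ₀(4)
(`Gamma0_four_le_thetaStabilizer`). Boundedness at all cusps follows from the growth bound O(1 +
1/Im τ). -/

namespace CycProd

/-! ### A Tauberian theorem for Laplace transforms. -/

open MeasureTheory Filter

open scoped FourierTransform in
/-- There is an approximate identity whose Fourier transform has compact support. -/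
theorem exists_bandlimited_kernel : ∃ K φ : ℝ → ℂ, Continuous K ∧ HasCompactSupport K ∧
    Continuous φ ∧ (∀ v, φ v = ∫ t : ℝ, Complex.exp (-(2 * π * Complex.I * t * v)) * K t) ∧
    Integrable φ ∧ Integrable (fun v => |v| * ‖φ v‖) ∧ ∫ v, φ v = 1 := by
  -- `K` is a smooth bump with `K 0 = 1`. Its Fourier transform is Schwartz, hence has a finite
  -- first moment, and Fourier inversion at 0 gives it integral 1.
  let b : ContDiffBump (0 : ℝ) := ⟨1, 2, one_pos, one_lt_two⟩
  let K : ℝ → ℂ := fun t => (b t : ℂ)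
  have hc : HasCompactSupport K := b.hasCompactSupport.comp_left Complex.ofReal_zero
  have hs : ContDiff ℝ (⊤ : ℕ∞) K := Complex.ofRealCLM.contDiff.comp b.contDiff
  let KS : SchwartzMap ℝ ℂ := hc.toSchwartzMap hs
  have hK : (KS : ℝ → ℂ) = K := rfl
  have hφ : ((𝓕 KS : SchwartzMap ℝ ℂ) : ℝ → ℂ) = 𝓕 K := SchwartzMap.fourier_coe KS
  refine ⟨K, 𝓕 K, hs.continuous, hc, ?_, ?_, ?_, ?_, ?_⟩
  · rw [← hφ]; exact (𝓕 KS).continuous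
  · intro v
    rw [Real.fourier_eq']
    refine integral_congr_ae (.of_forall fun t => ?_)
    simp only [RCLike.inner_apply, conj_trivial, smul_eq_mul]
    congr 2
    push_cast
    ring
  · rw [← hφ]; exact (𝓕 KS).integrable
  · have := (𝓕 KS).integrable_pow_mul volume 1
    simpa [hφ] using! this
  · have h := congrFun (hs.continuous.fourierInv_fourier_eq KS.integrable
      (hφ ▸ (𝓕 KS).integrable)) 0
    rw [Real.fourierInv_eq'] at h
    have h0 : K 0 = 1 := by
      have : b 0 = 1 := b.one_of_mem_closedBall (Metric.mem_closedBall_self b.rIn_pos.le)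
      simp [K, this]
    rw [h0] at h
    simpa using h

section Tauberian

variable {D K φ : ℝ → ℂ} {C : ℝ}

theorem integrable_mul_exp_of_linear_growth (hm : Measurable D) (h0 : ∀ u ≤ 0, D u = 0)
    (hC : ∀ u, ‖D u‖ ≤ C + |u|) {s : ℂ} (hs : 0 < s.re) :
    Integrable fun u : ℝ => D u * Complex.exp (-s * u) := by
  have h1 : IntegrableOn (fun u : ℝ => D u * Complex.exp (-s * u)) (Set.Ioi 0) := by
    have e1 : IntegrableOn (fun u : ℝ => C * Real.exp (-s.re * u)) (Set.Ioi 0) :=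
      (integrableOn_exp_mul_Ioi (neg_lt_zero.2 hs) 0).const_mul C
    have e2 : IntegrableOn (fun u : ℝ => u * Real.exp (-s.re * u)) (Set.Ioi 0) := by
      have := integrableOn_rpow_mul_exp_neg_mul_rpow (s := 1) (p := 1) (by norm_num) one_pos hs
      simpa using this
    refine (e1.add e2).mono' ?_ ?_
    · exact (hm.mul (by fun_prop)).aestronglyMeasurable
    · filter_upwards [ae_restrict_mem measurableSet_Ioi] with u hu
      have hu' : 0 < u := hu
      have := hC u
      rw [abs_of_pos hu'] at this
      rw [norm_mul, Complex.norm_exp]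
      simp only [Complex.mul_re, Complex.neg_re, Complex.ofReal_re, Complex.neg_im,
        Complex.ofReal_im, mul_zero, sub_zero, Pi.add_apply]
      rw [← add_mul]
      gcongr
  refine (integrableOn_iff_integrable_of_support_subset ?_).1 h1
  intro u hu
  by_contra h
  exact hu (by simp [h0 u (not_lt.1 h)])

/-- Fubini after inserting the Fourier integral of `φ`; the damping by `ε` makes the double integral
absolutely convergent. The smoothed function thus sees the Laplace transform only on a compact piece
of the line Re s = ε. -/
theorem integral_mul_fourier_eq (hm : Measurable D) (h0 : ∀ u ≤ 0, D u = 0)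
    (hC : ∀ u, ‖D u‖ ≤ C + |u|) (hK : Continuous K) (hKc : HasCompactSupport K)
    (hφ : ∀ v, φ v = ∫ t : ℝ, Complex.exp (-(2 * π * Complex.I * t * v)) * K t)
    (lam U : ℝ) {ε : ℝ} (hε : 0 < ε) :
    ∫ u : ℝ, D u * Complex.exp (-ε * u) * φ (lam * (u - U)) =
      ∫ t : ℝ, Complex.exp (2 * π * Complex.I * t * (lam * U)) * (K t *
        ∫ u : ℝ, D u * Complex.exp (-(ε + 2 * π * lam * t * Complex.I) * u)) := by
  have hi := integrable_mul_exp_of_linear_growth hm h0 hC (s := ε) (by simpa using hε)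
  have hprod : Integrable (Function.uncurry fun u t : ℝ => (D u * Complex.exp (-ε * u)) *
      (Complex.exp (-(2 * π * Complex.I * t * (lam * (u - U) : ℝ))) * K t))
      (volume.prod volume) := by
    have h1 := hi.mul_prod (hK.integrable_of_hasCompactSupport (μ := volume) hKc)
    refine h1.mono ?_ (.of_forall fun p => ?_)
    · refine Measurable.aestronglyMeasurable ?_
      have := hK.measurable
      simp only [Function.uncurry_def]
      fun_prop
    · obtain ⟨u, t⟩ := p
      have : ‖Complex.exp (-(2 * π * Complex.I * t * (lam * (u - U) : ℝ)))‖ = 1 := by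
        rw [show -(2 * π * Complex.I * t * (lam * (u - U) : ℝ)) =
          ((-(2 * π * t * (lam * (u - U))) : ℝ) : ℂ) * Complex.I by push_cast; ring,
          Complex.norm_exp_ofReal_mul_I]
      simp only [Function.uncurry_apply_pair, norm_mul, this, one_mul]
      exact le_rfl
  have e1 : ∀ u : ℝ, D u * Complex.exp (-ε * u) * φ (lam * (u - U)) = ∫ t : ℝ,
      (D u * Complex.exp (-ε * u)) *
      (Complex.exp (-(2 * π * Complex.I * t * (lam * (u - U) : ℝ))) * K t) := by
    intro u
    rw [hφ, integral_const_mul]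
  simp_rw [e1]
  rw [integral_integral_swap hprod]
  refine integral_congr_ae (.of_forall fun t => ?_)
  simp only
  rw [← integral_const_mul, ← integral_const_mul]
  refine integral_congr_ae (.of_forall fun u => ?_)
  simp only
  rw [show -(ε + 2 * π * lam * t * Complex.I) * u = -ε * u + (-(2 * π * lam * t * Complex.I) * u)
    by ring, Complex.exp_add,
    show (-(2 * π * Complex.I * t * (lam * (u - U) : ℝ)) : ℂ) = 2 * π * Complex.I * t * (lam * U) +
      (-(2 * π * lam * t * Complex.I) * u) by push_cast; ring, Complex.exp_add]
  ring

theorem integrable_linear_growth_mul (hm : Measurable D) (hC : ∀ u, ‖D u‖ ≤ C + |u|)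
    (hφc : Continuous φ) (hφi : Integrable φ) (hφ1 : Integrable fun v => |v| * ‖φ v‖)
    {lam : ℝ} (hl : 0 < lam) (U : ℝ) :
    Integrable fun v : ℝ => D (U + v / lam) * φ v := by
  have hb : Integrable fun v : ℝ => (C + |U|) * ‖φ v‖ + (1 / lam) * (|v| * ‖φ v‖) :=
    (hφi.norm.const_mul _).add (hφ1.const_mul _)
  refine hb.mono' ?_ (.of_forall fun v => ?_)
  · have := hφc.measurable
    exact Measurable.aestronglyMeasurable (by fun_prop)
  · have h1 := hC (U + v / lam)
    have h2 : |U + v / lam| ≤ |U| + |v| / lam := by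
      refine (abs_add_le _ _).trans ?_
      rw [abs_div, abs_of_pos hl]
    rw [norm_mul]
    calc ‖D (U + v / lam)‖ * ‖φ v‖ ≤ (C + (|U| + |v| / lam)) * ‖φ v‖ := by gcongr; linarith
      _ = _ := by ring

theorem integral_comp_shift_scale (f : ℝ → ℂ) {lam : ℝ} (hl : 0 < lam) (U : ℝ) :
    ∫ v : ℝ, f (U + v / lam) = lam * ∫ u, f u := by
  have := Measure.integral_comp_div (fun v => f (U + v)) lam
  rw [this, integral_add_left_eq_self f U, abs_of_pos hl]
  simp

/-- Letting ε → 0 expresses the smoothed value at `U` as a Fourier integral of the compactly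
supported boundary function `R`; Riemann–Lebesgue then gives decay in `U`. -/
theorem tendsto_smoothed_zero (hm : Measurable D) (h0 : ∀ u ≤ 0, D u = 0)
    (hC : ∀ u, ‖D u‖ ≤ C + |u|) {G : ℂ → ℂ} (hG : ContinuousOn G {s | 0 ≤ s.re})
    (hL : ∀ s : ℂ, 0 < s.re → G s = ∫ u : ℝ, D u * Complex.exp (-s * u))
    (hK : Continuous K) (hKc : HasCompactSupport K) (hφc : Continuous φ)
    (hφ : ∀ v, φ v = ∫ t : ℝ, Complex.exp (-(2 * π * Complex.I * t * v)) * K t)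
    (hφi : Integrable φ) (hφ1 : Integrable fun v => |v| * ‖φ v‖) {lam : ℝ} (hl : 0 < lam) :
    Tendsto (fun U : ℝ => ∫ v : ℝ, D (U + v / lam) * φ v) atTop (𝓝 0) := by
  let R : ℝ → ℂ := fun t => K t * G (2 * π * lam * t * Complex.I)
  -- the identity on the boundary line
  have key : ∀ U : ℝ, ∫ v : ℝ, D (U + v / lam) * φ v =
      lam * ∫ t : ℝ, Complex.exp (2 * π * Complex.I * t * (lam * U)) * R t := by
    intro U
    have e : ∀ v : ℝ, D (U + v / lam) * φ v =
        (fun u => D u * φ (lam * (u - U))) (U + v / lam) := by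
      intro v
      simp only
      congr 2
      field_simp
      ring
    have hint : Integrable fun u : ℝ => D u * φ (lam * (u - U)) := by
      have h1 := integrable_linear_growth_mul hm hC hφc hφi hφ1 hl U
      have h2 := (h1.comp_mul_left' hl.ne').comp_sub_right U
      refine h2.congr (.of_forall fun u => ?_)
      simp only
      congr 2
      field_simp
      ring
    rw [integral_congr_ae (.of_forall e), integral_comp_shift_scale (fun u => D u * φ (lam * (u - U))) hl U]
    congr 1
    have t1 : Tendsto (fun ε : ℝ => ∫ u : ℝ, D u * Complex.exp (-ε * u) * φ (lam * (u - U)))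
        (𝓝[>] 0) (𝓝 (∫ u : ℝ, D u * φ (lam * (u - U)))) := by
      refine tendsto_integral_filter_of_dominated_convergence
        (fun u => ‖D u * φ (lam * (u - U))‖) ?_ ?_ hint.norm ?_
      · have := hφc.measurable
        exact .of_forall fun ε => Measurable.aestronglyMeasurable (by fun_prop)
      · filter_upwards [self_mem_nhdsWithin] with ε hε
        refine .of_forall fun u => ?_
        rcases le_or_gt u 0 with hu | hu
        · simp [h0 u hu]
        · rw [norm_mul, norm_mul, norm_mul, Complex.norm_exp]
          have : Real.exp (-(ε : ℂ) * u).re ≤ 1 := by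
            rw [Real.exp_le_one_iff]
            have : (0 : ℝ) < ε := hε
            simp
            positivity
          calc _ ≤ ‖D u‖ * 1 * ‖φ (lam * (u - U))‖ := by gcongr
            _ = _ := by ring
      · refine .of_forall fun u => ?_
        have : Continuous fun ε : ℝ => D u * Complex.exp (-ε * u) * φ (lam * (u - U)) := by
          fun_prop
        have h := (this.tendsto 0).mono_left (nhdsWithin_le_nhds (s := Set.Ioi 0))
        simpa using h
    have t2 : Tendsto (fun ε : ℝ => ∫ t : ℝ, Complex.exp (2 * π * Complex.I * t * (lam * U)) *
        (K t * G (ε + 2 * π * lam * t * Complex.I)))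
        (𝓝[>] 0) (𝓝 (∫ t : ℝ, Complex.exp (2 * π * Complex.I * t * (lam * U)) * R t)) := by
      have hre : ∀ ε t : ℝ, (ε + 2 * π * lam * t * Complex.I : ℂ).re = ε := by
        intro ε t
        simp
      -- Continuity of `G` up to the line bounds it on this compact set, which supplies the
      -- dominating function for ε → 0.
      let Q : Set (ℝ × ℝ) := Set.Icc 0 1 ×ˢ tsupport K
      have hQ : IsCompact Q := isCompact_Icc.prod hKc
      have hcont : ContinuousOn (fun p : ℝ × ℝ => G (p.1 + 2 * π * lam * p.2 * Complex.I)) Q := by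
        refine hG.comp (by fun_prop) ?_
        rintro ⟨ε, t⟩ hp
        simp only [Set.mem_ofPred_eq, hre]
        exact hp.1.1
      obtain ⟨M, hM⟩ := hQ.exists_bound_of_continuousOn hcont
      have hmeas : ∀ ε : ℝ, 0 ≤ ε → Continuous fun t : ℝ => G (ε + 2 * π * lam * t * Complex.I) := by
        intro ε hε
        refine hG.comp_continuous (by fun_prop) fun t => ?_
        simp only [Set.mem_ofPred_eq, hre]
        exact hε
      refine tendsto_integral_filter_of_dominated_convergence
        (fun t => ‖K t‖ * M) ?_ ?_ ?_ ?_
      · filter_upwards [self_mem_nhdsWithin] with ε hε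
        have he : Continuous fun t : ℝ => Complex.exp (2 * π * Complex.I * t * (lam * U)) := by
          fun_prop
        exact (he.mul (hK.mul (hmeas ε (le_of_lt hε)))).aestronglyMeasurable
      · filter_upwards [Ioc_mem_nhdsGT (zero_lt_one' ℝ)] with ε hε
        refine .of_forall fun t => ?_
        have h1 : ‖Complex.exp (2 * π * Complex.I * t * (lam * U))‖ = 1 := by
          rw [show (2 * π * Complex.I * t * (lam * U) : ℂ) =
            ((2 * π * t * (lam * U) : ℝ) : ℂ) * Complex.I by push_cast; ring,
            Complex.norm_exp_ofReal_mul_I]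
        rw [norm_mul, norm_mul, h1, one_mul]
        by_cases ht : t ∈ tsupport K
        · gcongr
          exact hM (ε, t) ⟨⟨hε.1.le, hε.2⟩, ht⟩
        · simp [image_eq_zero_of_notMem_tsupport ht]
      · exact (hK.integrable_of_hasCompactSupport hKc).norm.mul_const M
      · refine .of_forall fun t => ?_
        refine Tendsto.const_mul _ (Tendsto.const_mul _ ?_)
        have h1 : ContinuousWithinAt G {s | 0 ≤ s.re} (2 * π * lam * t * Complex.I) :=
          hG _ (by simp)
        refine h1.tendsto.comp (tendsto_nhdsWithin_iff.2 ⟨?_, ?_⟩)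
        · have : Continuous fun ε : ℝ => (ε + 2 * π * lam * t * Complex.I : ℂ) := by fun_prop
          have h := (this.tendsto 0).mono_left (nhdsWithin_le_nhds (s := Set.Ioi 0))
          simpa using h
        · filter_upwards [self_mem_nhdsWithin] with ε hε
          simp only [hre]
          exact le_of_lt hε
    refine tendsto_nhds_unique t1 (t2.congr' ?_)
    filter_upwards [self_mem_nhdsWithin] with ε hε
    rw [integral_mul_fourier_eq hm h0 hC hK hKc hφ lam U hε]
    refine integral_congr_ae (.of_forall fun t => ?_)
    simp only
    rw [hL]
    simpa using hε
  simp_rw [key]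
  rw [← mul_zero (lam : ℂ)]
  refine Tendsto.const_mul _ ?_
  have hRL := Real.tendsto_integral_exp_smul_cocompact R
  have hU : Tendsto (fun U : ℝ => -(lam * U)) atTop (cocompact ℝ) := by
    refine Tendsto.mono_right ?_ atBot_le_cocompact
    exact tendsto_neg_atTop_atBot.comp (tendsto_id.const_mul_atTop hl)
  refine (hRL.comp hU).congr fun U => ?_
  simp only [Function.comp]
  refine integral_congr_ae (.of_forall fun t => ?_)
  simp only [Circle.smul_def, Real.fourierChar_apply, smul_eq_mul]
  congr 2
  push_cast
  ring

/-- A Tauberian theorem for Laplace transforms of slowly oscillating functions. -/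
theorem tendsto_of_laplace_continuousOn {A : ℝ → ℂ} (hm : Measurable A) {B : ℝ}
    (hosc : ∀ w u : ℝ, 0 ≤ w → w ≤ u → ‖A u - A w‖ ≤ (u - w) + B * Real.exp (-w)) (c : ℂ)
    {G : ℂ → ℂ} (hG : ContinuousOn G {s | 0 ≤ s.re})
    (hL : ∀ s : ℂ, 0 < s.re → G s = ∫ u in Set.Ioi (0 : ℝ), (A u - c) * Complex.exp (-s * u)) :
    Tendsto A atTop (𝓝 c) := by
  have hB : 0 ≤ B := by
    have := hosc 0 0 le_rfl le_rfl
    simpa using this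
  let D : ℝ → ℂ := (Set.Ioi (0 : ℝ)).indicator fun u => A u - c
  have hDm : Measurable D := (hm.sub_const c).indicator measurableSet_Ioi
  have hD0 : ∀ u ≤ 0, D u = 0 := fun u hu => Set.indicator_of_notMem (not_lt.2 hu) _
  have hDp : ∀ u, 0 < u → D u = A u - c := fun u hu => Set.indicator_of_mem (Set.mem_Ioi.2 hu) _
  obtain ⟨C, hC0, hC⟩ : ∃ C : ℝ, 0 ≤ C ∧ ∀ u, ‖D u‖ ≤ C + |u| := by
    refine ⟨B + ‖A 0‖ + ‖c‖, by positivity, fun u => ?_⟩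
    rcases le_or_gt u 0 with hu | hu
    · rw [hD0 u hu, norm_zero]; positivity
    · rw [hDp u hu, abs_of_pos hu]
      have h1 := hosc 0 u le_rfl hu.le
      simp only [sub_zero, neg_zero, Real.exp_zero, mul_one] at h1
      calc ‖A u - c‖ = ‖(A u - A 0) + A 0 - c‖ := by congr 1; ring
        _ ≤ ‖A u - A 0‖ + ‖A 0‖ + ‖c‖ := (norm_sub_le _ _).trans (by gcongr; exact norm_add_le _ _)
        _ ≤ _ := by linarith
  have hLD : ∀ s : ℂ, 0 < s.re → G s = ∫ u : ℝ, D u * Complex.exp (-s * u) := by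
    intro s hs
    rw [hL s hs, ← integral_indicator measurableSet_Ioi]
    refine integral_congr_ae (.of_forall fun u => ?_)
    simp only [D, Set.indicator]
    split_ifs <;> simp
  obtain ⟨K, φ, hK, hKc, hφc, hφ, hφi, hφ1, hφ2⟩ := exists_bandlimited_kernel
  set M0 := ∫ v, ‖φ v‖ with hM0
  set M1 := ∫ v, |v| * ‖φ v‖ with hM1
  have hM0' : 0 ≤ M0 := integral_nonneg fun v => norm_nonneg _
  have hM1' : 0 ≤ M1 := integral_nonneg fun v => by positivity
  -- comparison of the function with its smoothed version
  have hcmp : ∀ lam U : ℝ, 0 < lam → 0 < U →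
      ‖D U - ∫ v : ℝ, D (U + v / lam) * φ v‖ ≤
        (5 / lam + 4 * C / (lam * U)) * M1 + B * Real.exp (-(U / 2)) * M0 := by
    intro lam U hl hU
    have hi := integrable_linear_growth_mul hDm hC hφc hφi hφ1 hl U
    have e1 : D U - ∫ v : ℝ, D (U + v / lam) * φ v =
        ∫ v : ℝ, (D U - D (U + v / lam)) * φ v := by
      simp_rw [sub_mul]
      rw [integral_sub (hφi.const_mul _) hi, integral_const_mul, hφ2, mul_one]
    have e2 : (5 / lam + 4 * C / (lam * U)) * M1 + B * Real.exp (-(U / 2)) * M0 =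
        ∫ v : ℝ, ((5 / lam + 4 * C / (lam * U)) * (|v| * ‖φ v‖) +
          B * Real.exp (-(U / 2)) * ‖φ v‖) := by
      rw [integral_add (hφ1.const_mul _) (hφi.norm.const_mul _), integral_const_mul,
        integral_const_mul]
    rw [e1, e2]
    refine norm_integral_le_of_norm_le ((hφ1.const_mul _).add (hφi.norm.const_mul _))
      (.of_forall fun v => ?_)
    rw [norm_mul, ← mul_assoc, ← add_mul]
    refine mul_le_mul_of_nonneg_right ?_ (norm_nonneg _)
    have hv : 0 ≤ |v| / lam := by positivity
    have hv2 : |v / lam| = |v| / lam := by rw [abs_div, abs_of_pos hl]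
    have hexp : 0 ≤ B * Real.exp (-(U / 2)) := by positivity
    have hq : (5 / lam + 4 * C / (lam * U)) * |v| = 5 * (|v| / lam) + 4 * C * (|v| / lam) / U := by
      field_simp
    have hq2 : 0 ≤ 4 * C * (|v| / lam) / U := by positivity
    rw [hq]
    -- Near `U`, slow oscillation applies. Otherwise `U ≤ 2|v|/lam`, and the linear growth bound `2C
    -- + 2U + |v|/lam` is at most `2C + 5|v|/lam`, whence the 5; the same inequality turns `2C` into
    -- the term with `4C`.
    rcases le_or_gt (U / 2) (U + v / lam) with h | h
    · have hu : 0 < U + v / lam := by linarith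
      rw [hDp U hU, hDp _ hu, sub_sub_sub_cancel_right]
      have hbound : ‖A U - A (U + v / lam)‖ ≤ |v| / lam + B * Real.exp (-(U / 2)) := by
        rcases le_total (U + v / lam) U with h' | h'
        · refine (hosc _ _ hu.le h').trans ?_
          have : U - (U + v / lam) ≤ |v| / lam := by
            rw [← hv2]; have := neg_abs_le (v / lam); linarith
          have : Real.exp (-(U + v / lam)) ≤ Real.exp (-(U / 2)) := Real.exp_le_exp.2 (by linarith)
          gcongr
        · rw [norm_sub_rev]
          refine (hosc _ _ hU.le h').trans ?_
          have : (U + v / lam) - U ≤ |v| / lam := by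
            rw [← hv2]; have := le_abs_self (v / lam); linarith
          have : Real.exp (-U) ≤ Real.exp (-(U / 2)) := Real.exp_le_exp.2 (by linarith)
          gcongr
      linarith
    · have h1 : U ≤ 2 * (|v| / lam) := by
        have := neg_abs_le (v / lam)
        rw [hv2] at this
        linarith
      have h2 : 2 * C ≤ 4 * C * (|v| / lam) / U := by
        rw [le_div_iff₀ hU]
        nlinarith
      have h3 : |U + v / lam| ≤ U + |v| / lam := by
        refine (abs_add_le _ _).trans ?_
        rw [hv2, abs_of_pos hU]
      have h4 := hC U
      have h5 := hC (U + v / lam)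
      rw [abs_of_pos hU] at h4
      have h6 := norm_sub_le (D U) (D (U + v / lam))
      linarith
  have hDlim : Tendsto D atTop (𝓝 0) := by
    rw [Metric.tendsto_nhds]
    intro ε hε
    -- The scale is fixed before `U → ∞`: it makes the part of the error that does not decay in `U`
    -- at most `ε/4`.
    set lam : ℝ := 20 * (M1 + 1) / ε with hlam
    have hl : 0 < lam := by positivity
    have hl5 : 5 / lam * M1 < ε / 2 := by
      rw [hlam]
      have : 5 / (20 * (M1 + 1) / ε) * M1 = (M1 / (M1 + 1)) * (ε / 4) := by
        field_simp
        ring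
      rw [this]
      have : M1 / (M1 + 1) ≤ 1 := (div_le_one (by positivity)).2 (by linarith)
      nlinarith
    have hs := tendsto_smoothed_zero hDm hD0 hC hG hLD hK hKc hφc hφ hφi hφ1 hl
    have hbd : Tendsto (fun U : ℝ => (5 / lam + 4 * C / (lam * U)) * M1 +
        B * Real.exp (-(U / 2)) * M0 + ‖∫ v : ℝ, D (U + v / lam) * φ v‖) atTop
        (𝓝 ((5 / lam + 0) * M1 + B * 0 * M0 + 0)) := by
      refine Tendsto.add (Tendsto.add ?_ ?_) (by simpa using hs.norm)
      · refine Tendsto.mul_const _ (Tendsto.const_add _ ?_)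
        exact Tendsto.const_div_atTop (tendsto_id.const_mul_atTop hl) _
      · refine Tendsto.mul_const _ (Tendsto.const_mul _ ?_)
        exact Real.tendsto_exp_neg_atTop_nhds_zero.comp (tendsto_id.atTop_div_const two_pos)
    have hlt : (5 / lam + 0) * M1 + B * 0 * M0 + 0 < ε := by
      simp only [add_zero, mul_zero, zero_mul]
      linarith
    filter_upwards [hbd.eventually_lt_const hlt, eventually_gt_atTop 0] with U h1 hU
    rw [dist_zero_right]
    refine lt_of_le_of_lt ?_ h1
    have := hcmp lam U hl hU
    have h2 := norm_sub_norm_le (D U) (∫ v : ℝ, D (U + v / lam) * φ v)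
    linarith
  have : Tendsto (fun u => D u + c) atTop (𝓝 c) := by simpa using hDlim.add_const c
  refine this.congr' ?_
  filter_upwards [eventually_gt_atTop 0] with u hu
  rw [hDp u hu, sub_add_cancel]

end Tauberian

end CycProd

/-! ### Convergence of Dirichlet series at the point 1. -/

namespace CycProd

open MeasureTheory Filter

theorem sum_inv_Ioc_le_log {m n : ℕ} (hm : 1 ≤ m) (hmn : m ≤ n) :
    ∑ k ∈ Finset.Ioc m n, (1 / k : ℝ) ≤ Real.log n - Real.log m := by
  induction n, hmn using Nat.le_induction with
  | base => simp
  | succ n hmn ih =>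
    rw [← Finset.sum_Ioc_consecutive _ hmn (Nat.le_succ n)]
    have hn : (0 : ℝ) < n := by exact_mod_cast (by omega : 0 < n)
    have h := Real.log_le_sub_one_of_pos (x := (n : ℝ) / (n + 1)) (by positivity)
    rw [Real.log_div hn.ne' (by positivity)] at h
    have e : (n : ℝ) / (n + 1) - 1 = -(1 / (n + 1)) := by field_simp; ring
    rw [e] at h
    simp only [Nat.Ioc_succ_singleton, Finset.sum_singleton]
    push_cast
    linarith

theorem norm_sum_div_Ioc_le {a : ℕ → ℂ} (ha : ∀ n, ‖a n‖ ≤ 1) (m n : ℕ) :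
    ‖∑ k ∈ Finset.Ioc m n, a k / k‖ ≤ ∑ k ∈ Finset.Ioc m n, (1 / k : ℝ) := by
  refine norm_sum_le_of_le _ fun k _ => ?_
  rw [norm_div, Complex.norm_natCast]
  gcongr
  exact ha k

/-- In logarithmic scale the harmonic sum between e^w and e^u has length u - w. Rounding e^w down to
`m` costs at most 1/m ≤ 2e^{-w}, because e^w < m + 1 ≤ 2m. -/
theorem norm_sum_div_floor_exp_sub_le {a : ℕ → ℂ} (ha : ∀ n, ‖a n‖ ≤ 1) {w u : ℝ} (hw : 0 ≤ w)
    (hwu : w ≤ u) :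
    ‖∑ k ∈ Finset.Icc 1 ⌊Real.exp u⌋₊, a k / k - ∑ k ∈ Finset.Icc 1 ⌊Real.exp w⌋₊, a k / k‖ ≤
      (u - w) + 2 * Real.exp (-w) := by
  set m := ⌊Real.exp w⌋₊ with hm
  set n := ⌊Real.exp u⌋₊ with hn
  have hm1 : 1 ≤ m := Nat.le_floor (by simpa using hw)
  have hmn : m ≤ n := Nat.floor_le_floor (Real.exp_le_exp.2 hwu)
  have e : ∑ k ∈ Finset.Icc 1 n, a k / k - ∑ k ∈ Finset.Icc 1 m, a k / k =
      ∑ k ∈ Finset.Ioc m n, a k / k := by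
    have h : ∀ j, Finset.Icc 1 j = Finset.Ioc 0 j := fun j => by ext; simp; omega
    rw [h, h, ← Finset.sum_Ioc_consecutive _ (Nat.zero_le m) hmn, add_sub_cancel_left]
  rw [e]
  refine (norm_sum_div_Ioc_le ha m n).trans ((sum_inv_Ioc_le_log hm1 hmn).trans ?_)
  have hm0 : (0 : ℝ) < m := by exact_mod_cast hm1
  have hn0 : (0 : ℝ) < n := by exact_mod_cast hm1.trans hmn
  have h1 : Real.log n ≤ u := by
    rw [Real.log_le_iff_le_exp hn0]
    exact Nat.floor_le (Real.exp_pos u).le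
  have h2 : Real.exp w < m + 1 := Nat.lt_floor_add_one _
  have h3 : w - Real.log m ≤ 2 * Real.exp (-w) := by
    have := Real.log_le_sub_one_of_pos (x := Real.exp w / m) (by positivity)
    rw [Real.log_div (Real.exp_pos w).ne' hm0.ne', Real.log_exp] at this
    refine this.trans ?_
    have h4 : Real.exp w / m - 1 ≤ 1 / m := by
      rw [div_sub_one hm0.ne']
      gcongr
      linarith
    refine h4.trans ?_
    rw [Real.exp_neg, ← div_eq_mul_inv, div_le_div_iff₀ hm0 (Real.exp_pos w)]
    have : (1 : ℝ) ≤ m := by exact_mod_cast hm1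
    linarith
  linarith

theorem sum_norm_div_isBigO {a : ℕ → ℂ} (ha : ∀ n, ‖a n‖ ≤ 1) {r : ℝ} (hr : 0 < r) :
    (fun n : ℕ => ∑ k ∈ Finset.Icc 1 n, ‖a k / k‖) =O[atTop] fun n => (n : ℝ) ^ r := by
  have h1 : (fun n : ℕ => ∑ k ∈ Finset.Icc 1 n, ‖a k / k‖) =O[atTop]
      fun n : ℕ => 1 + Real.log n := by
    refine Asymptotics.IsBigO.of_bound 1 (.of_forall fun n => ?_)
    rw [one_mul, Real.norm_of_nonneg (Finset.sum_nonneg fun k _ => norm_nonneg _)]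
    refine le_trans ?_ ((harmonic_le_one_add_log n).trans (Real.le_norm_self _))
    rw [harmonic_eq_sum_Icc]
    push_cast
    refine Finset.sum_le_sum fun k _ => ?_
    rw [norm_div, Complex.norm_natCast, ← one_div]
    gcongr
    exact ha k
  refine h1.trans ?_
  have h2 : (fun x : ℝ => 1 + Real.log x) =O[atTop] fun x => x ^ r := by
    refine Asymptotics.IsBigO.add ?_ (isLittleO_log_rpow_atTop hr).isBigO
    refine Asymptotics.IsBigO.of_bound 1 ?_
    filter_upwards [eventually_ge_atTop 1] with x hx
    rw [one_mul, norm_one]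
    exact (Real.one_le_rpow hx hr.le).trans (Real.le_norm_self _)
  exact h2.comp_tendsto tendsto_natCast_atTop_atTop

/-- Abel summation for the coefficients a_n / n, followed by the substitution x = e^u. -/
theorem LSeries_succ_eq_mul_laplace {a : ℕ → ℂ} (ha : ∀ n, ‖a n‖ ≤ 1) {s : ℂ} (hs : 0 < s.re) :
    LSeries a (1 + s) = s * ∫ u in Set.Ioi (0 : ℝ),
      (∑ k ∈ Finset.Icc 1 ⌊Real.exp u⌋₊, a k / k) * Complex.exp (-s * u) := by
  have e1 : LSeries a (1 + s) = LSeries (fun n => a n / n) s := by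
    refine tsum_congr fun n => ?_
    rcases Nat.eq_zero_or_pos n with rfl | hn
    · simp
    · have hn' : (n : ℂ) ≠ 0 := by exact_mod_cast hn.ne'
      rw [LSeries.term_of_ne_zero hn.ne', LSeries.term_of_ne_zero hn.ne', Complex.cpow_add _ _ hn',
        Complex.cpow_one, div_div]
  rw [e1, LSeries_eq_mul_integral' _ (r := s.re / 2) (by positivity) (by linarith)
    (sum_norm_div_isBigO ha (by positivity))]
  congr 1
  have himg : Real.exp '' Set.Ioi 0 = Set.Ioi 1 := by
    rw [← Real.exp_zero]
    ext x
    simp only [Set.mem_image, Set.mem_Ioi]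
    constructor
    · rintro ⟨y, hy, rfl⟩
      exact Real.exp_lt_exp.2 hy
    · intro hx
      have hx0 : 0 < x := (Real.exp_pos 0).trans hx
      exact ⟨Real.log x, Real.exp_lt_exp.1 (by rwa [Real.exp_log hx0]), Real.exp_log hx0⟩
  rw [← himg, integral_image_eq_integral_abs_deriv_smul measurableSet_Ioi
    (fun x _ => (Real.hasDerivAt_exp x).hasDerivWithinAt) Real.exp_injective.injOn]
  refine setIntegral_congr_fun measurableSet_Ioi fun u _ => ?_
  rw [abs_of_pos (Real.exp_pos u), Complex.real_smul, mul_left_comm]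
  congr 1
  rw [Complex.cpow_def_of_ne_zero (by exact_mod_cast (Real.exp_pos u).ne'),
    ← Complex.ofReal_log (Real.exp_pos u).le, Real.log_exp, Complex.ofReal_exp, ← Complex.exp_add]
  congr 1
  ring

/-- A bounded Dirichlet series with a holomorphic extension to `Re s ≥ 1` converges at `1`. -/
theorem tendsto_sum_div_of_LSeries_extension {a : ℕ → ℂ} (ha : ∀ n, ‖a n‖ ≤ 1) {F : ℂ → ℂ}
    (hF : ∀ s : ℂ, 1 ≤ s.re → DifferentiableAt ℂ F s)
    (hFa : ∀ s : ℂ, 1 < s.re → F s = LSeries a s) :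
    Tendsto (fun N : ℕ => ∑ k ∈ Finset.Icc 1 N, a k / k) atTop (𝓝 (F 1)) := by
  let A : ℝ → ℂ := fun u => ∑ k ∈ Finset.Icc 1 ⌊Real.exp u⌋₊, a k / k
  have hAm : Measurable A :=
    (measurable_from_nat (f := fun n : ℕ => ∑ k ∈ Finset.Icc 1 n, a k / k)).comp
      (Nat.measurable_floor.comp Real.measurable_exp)
  have hosc : ∀ w u : ℝ, 0 ≤ w → w ≤ u → ‖A u - A w‖ ≤ (u - w) + 2 * Real.exp (-w) :=
    fun w u hw hwu => norm_sum_div_floor_exp_sub_le ha hw hwu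
  -- The Laplace transform of `A - F 1` is the difference quotient (F(1+s) - F(1))/s; `dslope` fills
  -- in the derivative at s = 0, so no singularity remains on the line.
  have hG : ContinuousOn (fun s => dslope F 1 (1 + s)) {s : ℂ | 0 ≤ s.re} := by
    intro s hs
    refine ContinuousAt.continuousWithinAt ?_
    suffices h : ContinuousAt (dslope F 1) (1 + s) from
      ContinuousAt.comp (f := fun s : ℂ => 1 + s) h (by fun_prop)
    rcases eq_or_ne s 0 with rfl | hs0
    · rw [add_zero]
      exact continuousAt_dslope_same.2 (hF 1 (by simp))
    · rw [continuousAt_dslope_of_ne (by simpa using hs0)]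
      refine (hF _ ?_).continuousAt
      have : 0 ≤ s.re := hs
      simpa using this
  have hlim : Tendsto A atTop (𝓝 (F 1)) := by
    refine tendsto_of_laplace_continuousOn hAm hosc (F 1) hG fun s hs => ?_
    have hs0 : s ≠ 0 := by rintro rfl; simp at hs
    rw [dslope_of_ne _ (by simpa using hs0), slope_def_field, hFa (1 + s) (by simpa using hs),
      LSeries_succ_eq_mul_laplace ha hs, add_sub_cancel_left]
    have hexp : IntegrableOn (fun u : ℝ => Complex.exp (-s * u)) (Set.Ioi 0) :=
      integrableOn_exp_mul_complex_Ioi (by simpa using hs) 0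
    have hA : IntegrableOn (fun u : ℝ => A u * Complex.exp (-s * u)) (Set.Ioi 0) := by
      have := integrable_mul_exp_of_linear_growth (D := (Set.Ioi (0 : ℝ)).indicator A)
        (C := 2 + ‖A 0‖) (hAm.indicator measurableSet_Ioi)
        (fun u hu => Set.indicator_of_notMem (not_lt.2 hu) _) (fun u => ?_) hs
      · refine (integrable_indicator_iff measurableSet_Ioi).1 (this.congr (.of_forall fun u => ?_))
        simp only [Set.indicator]
        split_ifs <;> simp
      · by_cases hu : 0 < u
        · have h1 := hosc 0 u le_rfl hu.le
          simp only [sub_zero, neg_zero, Real.exp_zero, mul_one] at h1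
          rw [abs_of_pos hu, Set.indicator_of_mem (Set.mem_Ioi.2 hu)]
          have h2 := norm_sub_norm_le (A u) (A 0)
          linarith
        · rw [Set.indicator_of_notMem (by simpa using hu), norm_zero]
          positivity
    have hc : ∫ u in Set.Ioi (0 : ℝ), F 1 * Complex.exp (-s * u) = F 1 / s := by
      rw [integral_const_mul, integral_exp_mul_complex_Ioi (by simpa using hs)]
      simp [div_eq_mul_inv]
    simp_rw [sub_mul]
    rw [integral_sub hA (hexp.const_mul _), hc, sub_div, mul_div_cancel_left₀ _ hs0]
  have hlog : Tendsto (fun N : ℕ => Real.log N) atTop atTop :=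
    Real.tendsto_log_atTop.comp tendsto_natCast_atTop_atTop
  refine (hlim.comp hlog).congr' ?_
  filter_upwards [eventually_ge_atTop 1] with N hN
  simp only [Function.comp, A]
  rw [Real.exp_log (by exact_mod_cast hN), Nat.floor_natCast]

/-! ### The character modulo 4 and its Möbius series. -/

/-- The nontrivial complex Dirichlet character modulo `4`. -/
noncomputable def chi4 : DirichletCharacter ℂ 4 := ZMod.χ₄.ringHomComp (Int.castRingHom ℂ)

theorem chi4_apply (n : ℕ) : chi4 n = ((ZMod.χ₄ n : ℤ) : ℂ) := rfl

theorem chi4_ne_one : chi4 ≠ 1 := by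
  intro h
  have h1 : chi4 ((3 : ℕ) : ZMod 4) = 1 := by
    rw [h]
    exact MulChar.one_apply (by decide)
  rw [chi4_apply, show ZMod.χ₄ ((3 : ℕ) : ZMod 4) = -1 by decide] at h1
  norm_num at h1

theorem chi4_even (i : ℕ) : chi4 ((2 * i : ℕ) : ZMod 4) = 0 := by
  rw [chi4_apply, ZMod.χ₄_nat_eq_if_mod_four]
  simp

theorem chi4_odd (i : ℕ) : chi4 ((2 * i + 1 : ℕ) : ZMod 4) = (-1) ^ i := by
  rw [chi4_apply, ZMod.χ₄_nat_eq_if_mod_four]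
  rcases Nat.even_or_odd' i with ⟨j, rfl | rfl⟩
  · have h1 : (2 * (2 * j) + 1) % 2 ≠ 0 := by omega
    have h2 : (2 * (2 * j) + 1) % 4 = 1 := by omega
    simp [h2]
  · have h1 : (2 * (2 * j + 1) + 1) % 2 ≠ 0 := by omega
    have h2 : (2 * (2 * j + 1) + 1) % 4 ≠ 1 := by omega
    rw [if_neg h1, if_neg h2]
    simp [pow_succ]

theorem sum_Icc_chi4_mul (g : ℕ → ℂ) (N : ℕ) :
    ∑ k ∈ Finset.Icc 1 (2 * N), chi4 k * g k = ∑ i ∈ Finset.range N, (-1) ^ i * g (2 * i + 1) := by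
  induction N with
  | zero => simp
  | succ N ih =>
    rw [show 2 * (N + 1) = 2 * N + 1 + 1 by ring, Finset.sum_Icc_succ_top (by omega),
      Finset.sum_Icc_succ_top (by omega), ih, Finset.sum_range_succ, chi4_odd,
      show 2 * N + 1 + 1 = 2 * (N + 1) by ring, chi4_even]
    ring

/-- The Tauberian theorem identifies the value with the limit of the partial sums at 1, and
Leibniz's series evaluates that limit. -/
theorem LFunction_chi4_one : DirichletCharacter.LFunction chi4 1 = (π / 4 : ℂ) := by
  have h := tendsto_sum_div_of_LSeries_extension (a := fun n => chi4 n)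
    (fun n => chi4.norm_le_one _) (F := DirichletCharacter.LFunction chi4)
    (fun s _ => DirichletCharacter.differentiable_LFunction chi4_ne_one s)
    (fun s hs => DirichletCharacter.LFunction_eq_LSeries chi4 hs)
  have h2 := h.comp (tendsto_id.const_mul_atTop' (two_pos (α := ℕ)))
  have h3 : Tendsto (fun N : ℕ => ((∑ i ∈ Finset.range N, (-1 : ℝ) ^ i / (2 * i + 1) : ℝ) : ℂ))
      atTop (𝓝 ((π / 4 : ℝ) : ℂ)) :=
    (Complex.continuous_ofReal.tendsto _).comp Real.tendsto_sum_pi_div_four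
  have h4 := tendsto_nhds_unique (h2.congr fun N => ?_) h3
  · rw [h4]; push_cast; rfl
  · simp only [Function.comp, id]
    simp_rw [div_eq_mul_inv]
    rw [sum_Icc_chi4_mul (fun k => (k : ℂ)⁻¹)]
    push_cast
    rfl

/-- The partial sums of `∑ χ₄(m) μ(m) / m`. -/
noncomputable def chiMoebiusSum (N : ℕ) : ℂ :=
  ∑ k ∈ Finset.Icc 1 N, chi4 k * (ArithmeticFunction.moebius k : ℂ) / k

/-- The Dirichlet series of χ₄μ is 1/L(s,χ₄), which is holomorphic on Re s ≥ 1 since L(s,χ₄) has no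
zeros there. -/
theorem tendsto_chiMoebiusSum : Tendsto chiMoebiusSum atTop (𝓝 (4 / π)) := by
  have h := tendsto_sum_div_of_LSeries_extension
    (a := fun n => chi4 n * (ArithmeticFunction.moebius n : ℂ)) (fun n => ?_)
    (F := fun s => (DirichletCharacter.LFunction chi4 s)⁻¹) (fun s hs => ?_) (fun s hs => ?_)
  · rw [LFunction_chi4_one, inv_div] at h
    exact h
  · rw [norm_mul]
    refine mul_le_one₀ (chi4.norm_le_one _) (norm_nonneg _) ?_
    rw [Complex.norm_intCast]
    exact_mod_cast ArithmeticFunction.abs_moebius_le_one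
  · exact (DirichletCharacter.differentiable_LFunction chi4_ne_one s).inv
      (DirichletCharacter.LFunction_ne_zero_of_one_le_re chi4 (.inl chi4_ne_one) hs)
  · rw [DirichletCharacter.LFunction_eq_LSeries chi4 hs]
    exact inv_eq_of_mul_eq_one_right (DirichletCharacter.LSeries.mul_mu_eq_one chi4 hs)

end CycProd

/-! ### Jacobi's two-square theorem by Gaussian integers. -/

namespace CycProd

/-- The integer points on the circle `x² + y² = n`. -/
def circlePoints (n : ℕ) : Set (ℤ × ℤ) := {p | p.1 ^ 2 + p.2 ^ 2 = (n : ℤ)}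

theorem r2_eq_ncard (n : ℕ) : r2 n = (circlePoints n).ncard := rfl

theorem circlePoints_finite (n : ℕ) : (circlePoints n).Finite := by
  refine Set.Finite.subset ((Set.finite_Icc (-(n : ℤ)) n).prod (Set.finite_Icc (-(n : ℤ)) n)) ?_
  rintro ⟨x, y⟩ h
  have h : x ^ 2 + y ^ 2 = (n : ℤ) := h
  simp only [Set.mem_prod, Set.mem_Icc]
  have hx : |x| ≤ n := (Int.le_self_sq _).trans (by rw [sq_abs]; nlinarith)
  have hy : |y| ≤ n := (Int.le_self_sq _).trans (by rw [sq_abs]; nlinarith)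
  exact ⟨abs_le.1 hx, abs_le.1 hy⟩

/-- Multiplication by the Gaussian integer `a + bi`. -/
def gaussMul (a b : ℤ) (p : ℤ × ℤ) : ℤ × ℤ := (a * p.1 - b * p.2, a * p.2 + b * p.1)

theorem gaussMul_injective {a b : ℤ} (h : a ^ 2 + b ^ 2 ≠ 0) :
    Function.Injective (gaussMul a b) := by
  rintro ⟨x, y⟩ ⟨u, v⟩ e
  simp only [gaussMul, Prod.mk.injEq] at e
  obtain ⟨e1, e2⟩ := e
  have h1 : (a ^ 2 + b ^ 2) * (x - u) = 0 := by linear_combination a * e1 + b * e2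
  have h2 : (a ^ 2 + b ^ 2) * (y - v) = 0 := by linear_combination a * e2 - b * e1
  simp only [Prod.mk.injEq]
  exact ⟨by simpa [h, sub_eq_zero] using h1, by simpa [h, sub_eq_zero] using h2⟩

theorem gaussMul_mem {a b : ℤ} {m n : ℕ} (h : a ^ 2 + b ^ 2 = (m : ℤ)) {p : ℤ × ℤ}
    (hp : p ∈ circlePoints n) : gaussMul a b p ∈ circlePoints (m * n) := by
  have hp : p.1 ^ 2 + p.2 ^ 2 = (n : ℤ) := hp
  simp only [circlePoints, gaussMul, Set.mem_ofPred_eq]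
  push_cast
  rw [← h, ← hp]
  ring

theorem ncard_gaussMul_image {a b : ℤ} (h : a ^ 2 + b ^ 2 ≠ 0) (s : Set (ℤ × ℤ)) :
    (gaussMul a b '' s).ncard = s.ncard :=
  Set.ncard_image_of_injective _ (gaussMul_injective h)

/-- If `a² + b² = m`, then `a + bi` divides a Gaussian integer of norm `m n` as soon as the
imaginary part of the quotient is an integer. -/
theorem mem_gaussMul_image {a b : ℤ} {m n : ℕ} (hm : m.Prime) (h : a ^ 2 + b ^ 2 = (m : ℤ))
    {p : ℤ × ℤ} (hp : p ∈ circlePoints (m * n)) (hd : (m : ℤ) ∣ p.2 * a - p.1 * b) :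
    p ∈ gaussMul a b '' circlePoints n := by
  obtain ⟨x, y⟩ := p
  have hp : x ^ 2 + y ^ 2 = ((m * n : ℕ) : ℤ) := hp
  push_cast at hp
  simp only at hd
  have hm0 : (m : ℤ) ≠ 0 := by exact_mod_cast hm.ne_zero
  have hpr : Prime (m : ℤ) := Nat.prime_iff_prime_int.1 hm
  -- The squares of the real and imaginary parts of (x + yi)(a - bi) add up to m · mn, so the prime
  -- `m` divides one part if it divides the other.
  have hd2 : (m : ℤ) ∣ x * a + y * b := by
    have e : (x * a + y * b) ^ 2 = m * (m * n) - (y * a - x * b) * (y * a - x * b) := by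
      rw [← hp]
      nth_rewrite 1 [← h]
      ring
    refine hpr.dvd_of_dvd_pow (n := 2) ?_
    rw [e]
    exact dvd_sub (dvd_mul_right _ _) (hd.mul_right _)
  obtain ⟨v, hv⟩ := hd
  obtain ⟨u, hu⟩ := hd2
  have e1 : x = a * u - b * v := by
    refine mul_left_cancel₀ hm0 ?_
    nth_rewrite 1 [← h]
    linear_combination a * hu - b * hv
  have e2 : y = a * v + b * u := by
    refine mul_left_cancel₀ hm0 ?_
    nth_rewrite 1 [← h]
    linear_combination a * hv + b * hu
  refine ⟨(u, v), ?_, by simp [gaussMul, e1, e2]⟩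
  simp only [circlePoints, Set.mem_ofPred_eq]
  refine mul_left_cancel₀ hm0 ?_
  rw [← hp, e1, e2, ← h]
  ring

/-- Multiplication by 1 + i is a bijection between the two circles, since x² + y² even forces x ≡ y
modulo 2. -/
theorem r2_two_mul (n : ℕ) : r2 (2 * n) = r2 n := by
  have h : (1 : ℤ) ^ 2 + 1 ^ 2 = ((2 : ℕ) : ℤ) := by norm_num
  rw [r2_eq_ncard, r2_eq_ncard,
    ← ncard_gaussMul_image (a := 1) (b := 1) (by norm_num) (circlePoints n)]
  congr 1
  refine Set.Subset.antisymm (fun p hp => mem_gaussMul_image Nat.prime_two h hp ?_) ?_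
  · have hp : p.1 ^ 2 + p.2 ^ 2 = ((2 * n : ℕ) : ℤ) := hp
    have h2 : (2 : ℤ) ∣ p.1 ^ 2 + p.2 ^ 2 := ⟨n, by rw [hp]; push_cast; ring⟩
    have h3 : (2 : ℤ) ∣ (p.2 - p.1) ^ 2 := by
      have : (p.2 - p.1) ^ 2 = (p.1 ^ 2 + p.2 ^ 2) - 2 * (p.1 * p.2) := by ring
      rw [this]
      exact dvd_sub h2 (dvd_mul_right _ _)
    simpa using Int.prime_two.dvd_of_dvd_pow h3
  · rintro _ ⟨p, hp, rfl⟩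
    exact gaussMul_mem h hp

theorem r2_zero : r2 0 = 1 := by
  rw [r2_eq_ncard, Set.ncard_eq_one]
  refine ⟨(0, 0), Set.ext fun ⟨x, y⟩ => ?_⟩
  simp only [circlePoints, Set.mem_ofPred_eq, Set.mem_singleton_iff, Prod.mk.injEq]
  push_cast
  constructor
  · intro h
    constructor <;> nlinarith [sq_nonneg x, sq_nonneg y]
  · rintro ⟨rfl, rfl⟩
    norm_num

theorem r2_one : r2 1 = 4 := by
  have : circlePoints 1 = (({(1, 0), (-1, 0), (0, 1), (0, -1)} : Finset (ℤ × ℤ)) : Set (ℤ × ℤ)) := by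
    ext ⟨x, y⟩
    simp only [circlePoints, Set.mem_ofPred_eq, Finset.coe_insert, Finset.coe_singleton,
      Set.mem_insert_iff, Set.mem_singleton_iff, Prod.mk.injEq]
    push_cast
    constructor
    · intro h
      have hx : -1 ≤ x ∧ x ≤ 1 := by constructor <;> nlinarith [sq_nonneg y]
      have hy : -1 ≤ y ∧ y ≤ 1 := by constructor <;> nlinarith [sq_nonneg x]
      obtain ⟨h1, h2⟩ := hx
      obtain ⟨h3, h4⟩ := hy
      interval_cases x <;> interval_cases y <;> simp_all
    · rintro (⟨rfl, rfl⟩ | ⟨rfl, rfl⟩ | ⟨rfl, rfl⟩ | ⟨rfl, rfl⟩) <;> norm_num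
  rw [r2_eq_ncard, this, Set.ncard_coe_finset]
  rfl

/-- Points of norm `p n` with both coordinates divisible by `p`. -/
theorem ncard_circlePoints_of_dvd {p : ℕ} (hp : p.Prime) (n : ℕ) :
    {q ∈ circlePoints (p * n) | (p : ℤ) ∣ q.1 ∧ (p : ℤ) ∣ q.2}.ncard =
      if p ∣ n then r2 (n / p) else 0 := by
  have hp0 : (p : ℤ) ≠ 0 := by exact_mod_cast hp.ne_zero
  split_ifs with h
  · obtain ⟨m, rfl⟩ := h
    rw [Nat.mul_div_cancel_left _ hp.pos, r2_eq_ncard,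
      ← ncard_gaussMul_image (a := p) (b := 0) (by simpa using hp.ne_zero) (circlePoints m)]
    congr 1
    refine Set.Subset.antisymm ?_ ?_
    · rintro ⟨x, y⟩ ⟨hq, ⟨u, hu⟩, ⟨v, hv⟩⟩
      simp only at hu hv
      subst hu
      subst hv
      have hq : (p * u : ℤ) ^ 2 + (p * v) ^ 2 = ((p * (p * m) : ℕ) : ℤ) := hq
      refine ⟨(u, v), ?_, by simp [gaussMul]⟩
      simp only [circlePoints, Set.mem_ofPred_eq]
      refine mul_left_cancel₀ (mul_ne_zero hp0 hp0) ?_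
      push_cast at hq
      linear_combination hq
    · rintro _ ⟨q, hq, rfl⟩
      refine ⟨?_, by simp [gaussMul]⟩
      rw [← mul_assoc]
      exact gaussMul_mem (by push_cast; ring) hq
  · rw [Set.ncard_eq_zero ((circlePoints_finite _).subset (Set.sep_subset _ _)),
      Set.eq_empty_iff_forall_notMem]
    rintro ⟨x, y⟩ ⟨hq, ⟨u, hu⟩, ⟨v, hv⟩⟩
    simp only at hu hv
    subst hu
    subst hv
    have hq : (p * u : ℤ) ^ 2 + (p * v) ^ 2 = ((p * n : ℕ) : ℤ) := hq
    refine h ?_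
    rw [← Int.natCast_dvd_natCast]
    refine ⟨u ^ 2 + v ^ 2, mul_left_cancel₀ hp0 ?_⟩
    push_cast at hq
    linear_combination -hq

/-- Here -1 is not a square modulo `p`, so `p` divides both coordinates of every point. -/
theorem r2_mul_of_three_mod_four {p : ℕ} (hp : p.Prime) (h3 : p % 4 = 3) (n : ℕ) :
    r2 (p * n) = if p ∣ n then r2 (n / p) else 0 := by
  rw [← ncard_circlePoints_of_dvd hp, r2_eq_ncard]
  congr 1
  refine (Set.sep_eq_self_iff_mem_true.2 ?_).symm
  rintro ⟨x, y⟩ hq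
  have hq : x ^ 2 + y ^ 2 = ((p * n : ℕ) : ℤ) := hq
  have := Fact.mk hp
  have hz : (x : ZMod p) ^ 2 + (y : ZMod p) ^ 2 = 0 := by
    have := congrArg (Int.cast : ℤ → ZMod p) hq
    push_cast at this
    simpa using this
  simp only
  rw [← ZMod.intCast_zmod_eq_zero_iff_dvd x p, ← ZMod.intCast_zmod_eq_zero_iff_dvd y p]
  constructor
  · by_contra hx
    exact ZMod.mod_four_ne_three_of_sq_eq_neg_sq' hx
      (eq_neg_of_add_eq_zero_left (by rwa [add_comm])) h3
  · by_contra hy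
    exact ZMod.mod_four_ne_three_of_sq_eq_neg_sq' hy (eq_neg_of_add_eq_zero_left hz) h3

/-- With p = (a + bi)(a - bi), every point of norm `p n` is divisible by one of the two factors, and
by both exactly when it is divisible by `p`. Inclusion–exclusion counts them. -/
theorem r2_mul_of_one_mod_four {p : ℕ} (hp : p.Prime) (h1 : p % 4 = 1) (n : ℕ) :
    r2 (p * n) + (if p ∣ n then r2 (n / p) else 0) = 2 * r2 n := by
  have := Fact.mk hp
  obtain ⟨a', b', hab'⟩ := Nat.Prime.sq_add_sq (p := p) (by omega)
  obtain ⟨a, b, hab⟩ : ∃ a b : ℤ, a ^ 2 + b ^ 2 = (p : ℤ) := ⟨a', b', by exact_mod_cast hab'⟩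
  have hab2 : a ^ 2 + (-b) ^ 2 = (p : ℤ) := by rw [neg_sq, hab]
  have hp0 : (p : ℤ) ≠ 0 := by exact_mod_cast hp.ne_zero
  have hpr : Prime (p : ℤ) := Nat.prime_iff_prime_int.1 hp
  have hpa : ¬ (p : ℤ) ∣ 2 * a := by
    intro h
    rcases hpr.dvd_or_dvd h with h | h
    · have := (Int.natCast_dvd_natCast (m := p) (n := 2)).1 (by exact_mod_cast h)
      have := Nat.le_of_dvd two_pos this
      have := hp.two_le
      omega
    · obtain ⟨c, rfl⟩ := h
      have hb : (p : ℤ) ∣ b := by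
        refine hpr.dvd_of_dvd_pow (n := 2) ⟨1 - p * c ^ 2, ?_⟩
        linear_combination hab
      obtain ⟨d, rfl⟩ := hb
      have : (p : ℤ) * (c ^ 2 + d ^ 2) = 1 := by
        refine mul_left_cancel₀ hp0 ?_
        linear_combination hab
      exact hpr.not_isUnit (IsUnit.of_mul_eq_one _ this)
  have hU : circlePoints (p * n) = gaussMul a b '' circlePoints n ∪
      gaussMul a (-b) '' circlePoints n := by
    refine Set.Subset.antisymm ?_ (Set.union_subset ?_ ?_)
    · rintro ⟨x, y⟩ hq
      have hq' : x ^ 2 + y ^ 2 = ((p * n : ℕ) : ℤ) := hq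
      push_cast at hq'
      have hd : (p : ℤ) ∣ (y * a - x * b) * (y * a - x * (-b)) :=
        ⟨a ^ 2 * n - x ^ 2, by linear_combination a ^ 2 * hq' - x ^ 2 * hab⟩
      rcases hpr.dvd_or_dvd hd with h | h
      · exact .inl (mem_gaussMul_image hp hab hq h)
      · exact .inr (mem_gaussMul_image hp hab2 hq h)
    · rintro _ ⟨q, hq, rfl⟩
      exact gaussMul_mem hab hq
    · rintro _ ⟨q, hq, rfl⟩
      exact gaussMul_mem hab2 hq
  have hI : {q ∈ circlePoints (p * n) | (p : ℤ) ∣ q.1 ∧ (p : ℤ) ∣ q.2} =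
      gaussMul a b '' circlePoints n ∩ gaussMul a (-b) '' circlePoints n := by
    refine Set.Subset.antisymm ?_ ?_
    · rintro q ⟨hq, h1, h2⟩
      exact ⟨mem_gaussMul_image hp hab hq (dvd_sub (h2.mul_right _) (h1.mul_right _)),
        mem_gaussMul_image hp hab2 hq (dvd_sub (h2.mul_right _) (h1.mul_right _))⟩
    · rintro _ ⟨⟨⟨x, y⟩, hq, rfl⟩, ⟨⟨u, v⟩, hq', e⟩⟩
      refine ⟨gaussMul_mem hab hq, ?_⟩
      simp only [gaussMul, Prod.mk.injEq] at e ⊢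
      obtain ⟨e1, e2⟩ := e
      -- If w = (a + bi)(x + yi) = (a - bi)(u + vi), multiplying by the conjugate factors and adding
      -- gives 2a·w = p((x + u) + (y + v)i); `2a` is then cancelled by `hpa`.
      have d1 : (p : ℤ) ∣ (2 * a) * (a * x - b * y) :=
        ⟨x + u, by linear_combination (-a) * e1 + b * e2 + (x + u) * hab⟩
      have d2 : (p : ℤ) ∣ (2 * a) * (a * y + b * x) :=
        ⟨y + v, by linear_combination (-a) * e2 - b * e1 + (y + v) * hab⟩
      exact ⟨(hpr.dvd_or_dvd d1).resolve_left hpa, (hpr.dvd_or_dvd d2).resolve_left hpa⟩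
  have hfin := circlePoints_finite n
  have := Set.ncard_union_add_ncard_inter (gaussMul a b '' circlePoints n)
    (gaussMul a (-b) '' circlePoints n) (hfin.image _) (hfin.image _)
  rw [← hU, ← hI, ncard_circlePoints_of_dvd hp, ncard_gaussMul_image (by rw [hab]; exact hp0),
    ncard_gaussMul_image (by rw [hab2]; exact hp0)] at this
  simp only [r2_eq_ncard] at this ⊢
  omega

/-- `∑_{d ∣ n} χ₄(d)`. -/
def chiDivisorSum (n : ℕ) : ℤ := ∑ d ∈ n.divisors, ZMod.χ₄ d

/-- The divisors of `p n` are those of `n` together with their multiples by `p`; the overlap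
consists of `p` times the divisors of `n / p`. -/
theorem chiDivisorSum_mul {p : ℕ} (hp : p.Prime) {n : ℕ} (hn : n ≠ 0) :
    chiDivisorSum (p * n) + ZMod.χ₄ p * (if p ∣ n then chiDivisorSum (n / p) else 0) =
      (1 + ZMod.χ₄ p) * chiDivisorSum n := by
  have himg : ∀ m : ℕ, ∑ d ∈ m.divisors.image (p * ·), ZMod.χ₄ (d : ZMod 4) =
      ZMod.χ₄ p * chiDivisorSum m := by
    intro m
    rw [Finset.sum_image (fun x _ y _ h => Nat.eq_of_mul_eq_mul_left hp.pos h), chiDivisorSum,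
      Finset.mul_sum]
    refine Finset.sum_congr rfl fun d _ => ?_
    rw [Nat.cast_mul, map_mul]
  have hU : (p * n).divisors = n.divisors ∪ n.divisors.image (p * ·) := by
    ext d
    simp only [Nat.mem_divisors, Finset.mem_union, Finset.mem_image]
    constructor
    · rintro ⟨hd, -⟩
      by_cases hpd : p ∣ d
      · obtain ⟨e, rfl⟩ := hpd
        exact .inr ⟨e, ⟨Nat.dvd_of_mul_dvd_mul_left hp.pos hd, hn⟩, rfl⟩
      · exact .inl ⟨((Nat.Prime.coprime_iff_not_dvd hp).2 hpd).symm.dvd_of_dvd_mul_left hd, hn⟩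
    · rintro (⟨hd, -⟩ | ⟨e, ⟨he, -⟩, rfl⟩)
      · exact ⟨hd.mul_left p, mul_ne_zero hp.ne_zero hn⟩
      · exact ⟨Nat.mul_dvd_mul_left p he, mul_ne_zero hp.ne_zero hn⟩
  have hI : ∑ d ∈ n.divisors ∩ n.divisors.image (p * ·), ZMod.χ₄ (d : ZMod 4) =
      ZMod.χ₄ p * (if p ∣ n then chiDivisorSum (n / p) else 0) := by
    split_ifs with h
    · rw [← himg]
      congr 1
      obtain ⟨m, rfl⟩ := h
      rw [Nat.mul_div_cancel_left _ hp.pos]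
      have hm : m ≠ 0 := right_ne_zero_of_mul hn
      ext d
      simp only [Nat.mem_divisors, Finset.mem_inter, Finset.mem_image]
      constructor
      · rintro ⟨⟨hd, -⟩, ⟨e, -, rfl⟩⟩
        exact ⟨e, ⟨Nat.dvd_of_mul_dvd_mul_left hp.pos hd, hm⟩, rfl⟩
      · rintro ⟨e, ⟨he, -⟩, rfl⟩
        exact ⟨⟨Nat.mul_dvd_mul_left p he, hn⟩, ⟨e, ⟨he.mul_left p, hn⟩, rfl⟩⟩
    · rw [mul_zero]
      refine Finset.sum_eq_zero fun d hd => ?_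
      simp only [Nat.mem_divisors, Finset.mem_inter, Finset.mem_image] at hd
      obtain ⟨⟨hd, -⟩, ⟨e, -, rfl⟩⟩ := hd
      exact absurd ((dvd_mul_right p e).trans hd) h
  have h := Finset.sum_union_inter (s₁ := n.divisors) (s₂ := n.divisors.image (p * ·))
    (f := fun d : ℕ => ZMod.χ₄ (d : ZMod 4))
  rw [← hU, hI, himg] at h
  rw [chiDivisorSum, h, add_mul, one_mul]
  rfl

/-- Jacobi's two-square theorem. -/
theorem r2_eq_four_mul_chiDivisorSum {n : ℕ} (hn : n ≠ 0) : (r2 n : ℤ) = 4 * chiDivisorSum n := by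
  -- Both sides obey the same recursion on removing a prime factor, where χ₄(p) = 0, 1, -1 matches
  -- `p` ramified, split or inert in ℤ[i].
  induction n using Nat.strong_induction_on with
  | _ n ih =>
    rcases eq_or_ne n 1 with rfl | h1
    · simp [r2_one, chiDivisorSum]
    · obtain ⟨p, hp, m, rfl⟩ := Nat.exists_prime_and_dvd h1
      have hm : m ≠ 0 := right_ne_zero_of_mul hn
      have hlt : m < p * m := by
        have := hp.two_le
        have := Nat.pos_of_ne_zero hm
        nlinarith
      have ihm := ih m hlt hm
      have ihq : ((if p ∣ m then r2 (m / p) else 0 : ℕ) : ℤ) =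
          4 * (if p ∣ m then chiDivisorSum (m / p) else 0) := by
        split_ifs with h
        · exact ih _ ((Nat.div_le_self m p).trans_lt hlt)
            (Nat.div_pos (Nat.le_of_dvd (Nat.pos_of_ne_zero hm) h) hp.pos).ne'
        · simp
      have hH := chiDivisorSum_mul hp hm
      rcases hp.eq_two_or_odd with rfl | hodd
      · have hχ : ZMod.χ₄ ((2 : ℕ) : ZMod 4) = 0 := by decide
        rw [hχ] at hH
        rw [r2_two_mul, ihm]
        linarith
      · rcases (by omega : p % 4 = 1 ∨ p % 4 = 3) with h | h
        · rw [ZMod.χ₄_nat_one_mod_four h] at hH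
          have := r2_mul_of_one_mod_four hp h m
          have := congrArg (Nat.cast : ℕ → ℤ) this
          rw [Nat.cast_add, ihq, Nat.cast_mul, ihm] at this
          push_cast at this
          linarith
        · rw [ZMod.χ₄_nat_three_mod_four h] at hH
          rw [r2_mul_of_three_mod_four hp h m, ihq]
          linarith

end CycProd

/-! ### Ramanujan sums and Ramanujan's formula. -/

namespace CycProd

open Filter

theorem sum_exp_two_pi_mul_div (q n : ℕ) (hq : q ≠ 0) :
    ∑ k ∈ Finset.Icc 1 q, Complex.exp (2 * π * Complex.I * k * n / q) =
      if q ∣ n then (q : ℂ) else 0 := by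
  have hqc : (q : ℂ) ≠ 0 := by exact_mod_cast hq
  set w : ℂ := Complex.exp (2 * π * Complex.I * n / q) with hw
  have hpow : ∀ k : ℕ, Complex.exp (2 * π * Complex.I * k * n / q) = w ^ k := by
    intro k
    rw [hw, ← Complex.exp_nat_mul]
    congr 1
    ring
  have hwq : w ^ q = 1 := by
    rw [hw, ← Complex.exp_nat_mul, Complex.exp_eq_one_iff]
    exact ⟨n, by push_cast; field_simp⟩
  have hsum : ∑ k ∈ Finset.Icc 1 q, w ^ k = w * ∑ k ∈ Finset.range q, w ^ k := by
    rw [Finset.mul_sum, Finset.range_eq_Ico, ← Finset.Ico_add_one_right_eq_Icc,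
      Finset.sum_Ico_eq_sum_range, Finset.sum_Ico_eq_sum_range]
    refine Finset.sum_congr (by simp) fun k _ => ?_
    rw [← pow_succ']
    congr 1
    omega
  simp_rw [hpow]
  rw [hsum]
  have hiff : w = 1 ↔ q ∣ n := by
    rw [hw, Complex.exp_eq_one_iff]
    constructor
    · rintro ⟨m, hm⟩
      have h2 : (2 * π * Complex.I : ℂ) ≠ 0 := Complex.two_pi_I_ne_zero
      have h3 : (n : ℂ) = q * m := by
        field_simp at hm
        have := mul_left_cancel₀ h2 (by linear_combination (2 * π * Complex.I) * hm :
          (2 * π * Complex.I : ℂ) * n = (2 * π * Complex.I) * (q * m))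
        exact this
      have h4 : (n : ℤ) = q * m := by exact_mod_cast h3
      exact Int.natCast_dvd_natCast.1 ⟨m, h4⟩
    · rintro ⟨m, rfl⟩
      exact ⟨m, by push_cast; field_simp⟩
  split_ifs with h
  · rw [hiff.2 h]
    simp
  · have h1 : w ≠ 1 := fun h' => h (hiff.1 h')
    rw [geom_sum_eq h1, hwq, sub_self, zero_div, mul_zero]

/-- Sort the fractions k/q by their reduced denominators; the full exponential sum modulo `q` is
then evaluated by orthogonality. -/
theorem sum_divisors_ramanujanSum (q n : ℕ) (hq : q ≠ 0) :
    ∑ d ∈ q.divisors, ramanujanSum d n = if q ∣ n then (q : ℂ) else 0 := by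
  rw [← sum_exp_two_pi_mul_div q n hq]
  simp only [ramanujanSum]
  rw [Finset.sum_sigma']
  have hqpos := Nat.pos_of_ne_zero hq
  refine Finset.sum_bij' (fun x _ => q / x.1 * x.2)
    (fun k _ => ⟨q / Nat.gcd k q, k / Nat.gcd k q⟩) ?_ ?_ ?_ ?_ ?_
  · rintro ⟨d, j⟩ h
    simp only [Finset.mem_sigma, Nat.mem_divisors, units, Finset.mem_filter, Finset.mem_Icc] at h ⊢
    obtain ⟨⟨⟨e, rfl⟩, -⟩, ⟨h1, h2⟩, -⟩ := h
    have hd : 0 < d := by omega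
    have he : 0 < e := Nat.pos_of_ne_zero (right_ne_zero_of_mul hq)
    rw [Nat.mul_div_cancel_left _ hd]
    exact ⟨Nat.mul_pos he h1, by rw [mul_comm d]; exact Nat.mul_le_mul_left e h2⟩
  · intro k h
    simp only [Finset.mem_sigma, Nat.mem_divisors, units, Finset.mem_filter, Finset.mem_Icc] at h ⊢
    have hg : 0 < Nat.gcd k q := Nat.gcd_pos_of_pos_right k hqpos
    refine ⟨⟨Nat.div_dvd_of_dvd (Nat.gcd_dvd_right k q), hq⟩, ⟨?_, ?_⟩, ?_⟩
    · exact Nat.div_pos (Nat.le_of_dvd (by omega) (Nat.gcd_dvd_left k q)) hg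
    · exact Nat.div_le_div_right h.2
    · exact Nat.gcd_div_gcd_div_gcd_of_pos_right hqpos
  · rintro ⟨d, j⟩ h
    simp only [Finset.mem_sigma, Nat.mem_divisors, units, Finset.mem_filter, Finset.mem_Icc] at h
    obtain ⟨⟨⟨e, rfl⟩, -⟩, ⟨h1, h2⟩, hg⟩ := h
    have hd : 0 < d := by omega
    have he : 0 < e := Nat.pos_of_ne_zero (right_ne_zero_of_mul hq)
    have hgcd : Nat.gcd (e * j) (d * e) = e := by
      rw [mul_comm d, Nat.gcd_mul_left, hg, mul_one]
    simp only [Nat.mul_div_cancel_left _ hd, hgcd, Nat.mul_div_cancel_left _ he,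
      Nat.mul_div_cancel _ he]
  · intro k h
    simp only [Finset.mem_Icc] at h
    have hg : 0 < Nat.gcd k q := Nat.gcd_pos_of_pos_right k hqpos
    simp only
    rw [Nat.div_div_self (Nat.gcd_dvd_right k q) hq, Nat.mul_div_cancel' (Nat.gcd_dvd_left k q)]
  · rintro ⟨d, j⟩ h
    simp only [Finset.mem_sigma, Nat.mem_divisors] at h
    obtain ⟨⟨⟨e, rfl⟩, -⟩, -⟩ := h
    have hd : d ≠ 0 := left_ne_zero_of_mul hq
    have he : (e : ℂ) ≠ 0 := by exact_mod_cast right_ne_zero_of_mul hq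
    have hd' : (d : ℂ) ≠ 0 := by exact_mod_cast hd
    simp only
    rw [Nat.mul_div_cancel_left _ (Nat.pos_of_ne_zero hd)]
    congr 1
    push_cast
    field_simp

/-- Möbius inversion, arranged over the divisors of `n` so that the range of summation does not
depend on `q`. -/
theorem ramanujanSum_eq (q n : ℕ) (hq : q ≠ 0) (hn : n ≠ 0) :
    ramanujanSum q n =
      ∑ d ∈ n.divisors, if d ∣ q then (ArithmeticFunction.moebius (q / d) : ℂ) * d else 0 := by
  have h := (ArithmeticFunction.sum_eq_iff_sum_mul_moebius_eq
    (f := fun q => ramanujanSum q n) (g := fun q => if q ∣ n then (q : ℂ) else 0)).1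
    (fun q hq => sum_divisors_ramanujanSum q n hq.ne') q (Nat.pos_of_ne_zero hq)
  rw [← h, Nat.sum_divisorsAntidiagonal'
    (f := fun a b => (ArithmeticFunction.moebius a : ℂ) * if b ∣ n then (b : ℂ) else 0)]
  simp_rw [mul_ite, mul_zero]
  rw [← Finset.sum_filter, ← Finset.sum_filter]
  congr 1
  ext d
  simp only [Finset.mem_filter, Nat.mem_divisors]
  tauto

/-- Put q = de and use χ₄(de) = χ₄(d)χ₄(e) and d/q = 1/e. The identity is exact for partial sums, so
it yields both the limit and a bound uniform in the cutoff. -/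
theorem sum_chi4_ramanujanSum (Q n : ℕ) (hn : n ≠ 0) :
    ∑ q ∈ Finset.Icc 1 Q, chi4 q * (ramanujanSum q n / q) =
      ∑ d ∈ n.divisors, chi4 d * chiMoebiusSum (Q / d) := by
  have e1 : ∀ q ∈ Finset.Icc 1 Q, chi4 q * (ramanujanSum q n / q) = ∑ d ∈ n.divisors,
      if d ∣ q then chi4 q * ((ArithmeticFunction.moebius (q / d) : ℂ) * d / q) else 0 := by
    intro q hq
    rw [ramanujanSum_eq q n (by have := (Finset.mem_Icc.1 hq).1; omega) hn, Finset.sum_div,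
      Finset.mul_sum]
    refine Finset.sum_congr rfl fun d _ => ?_
    split_ifs <;> simp
  rw [Finset.sum_congr rfl e1, Finset.sum_comm]
  refine Finset.sum_congr rfl fun d hd => ?_
  have hd0 : 0 < d := Nat.pos_of_mem_divisors hd
  have hdc : (d : ℂ) ≠ 0 := by exact_mod_cast hd0.ne'
  rw [← Finset.sum_filter, chiMoebiusSum, Finset.mul_sum]
  have himg : (Finset.Icc 1 Q).filter (d ∣ ·) = (Finset.Icc 1 (Q / d)).image (d * ·) := by
    ext q
    simp only [Finset.mem_filter, Finset.mem_Icc, Finset.mem_image]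
    constructor
    · rintro ⟨⟨h1, h2⟩, ⟨e, rfl⟩⟩
      exact ⟨e, ⟨Nat.pos_of_mul_pos_left h1, (Nat.le_div_iff_mul_le hd0).2 (by linarith)⟩, rfl⟩
    · rintro ⟨e, ⟨h1, h2⟩, rfl⟩
      rw [Nat.le_div_iff_mul_le hd0] at h2
      exact ⟨⟨Nat.mul_pos hd0 h1, by linarith⟩, dvd_mul_right _ _⟩
  rw [himg, Finset.sum_image (fun x _ y _ h => Nat.eq_of_mul_eq_mul_left hd0 h)]
  refine Finset.sum_congr rfl fun e he => ?_
  have hec : (e : ℂ) ≠ 0 := by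
    have := (Finset.mem_Icc.1 he).1
    exact_mod_cast (by omega : e ≠ 0)
  rw [Nat.mul_div_cancel_left _ hd0]
  push_cast
  rw [map_mul]
  field_simp

/-- The partial sums of Ramanujan's series for `r₂(n) / π`. -/
noncomputable def ramanujanPartialSum (N n : ℕ) : ℂ :=
  ∑ i ∈ Finset.range N, (-1 : ℂ) ^ i * ramanujanSum (2 * i + 1) n / (2 * i + 1)

theorem ramanujanPartialSum_eq (N n : ℕ) (hn : n ≠ 0) :
    ramanujanPartialSum N n = ∑ d ∈ n.divisors, chi4 d * chiMoebiusSum (2 * N / d) := by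
  rw [← sum_chi4_ramanujanSum _ _ hn, sum_Icc_chi4_mul (fun q => ramanujanSum q n / q),
    ramanujanPartialSum]
  refine Finset.sum_congr rfl fun i _ => ?_
  push_cast
  rw [mul_div_assoc]

theorem sum_divisors_chi4 (n : ℕ) : ∑ d ∈ n.divisors, chi4 d = (chiDivisorSum n : ℂ) := by
  rw [chiDivisorSum]
  push_cast
  rfl

theorem tendsto_ramanujanPartialSum {n : ℕ} (hn : n ≠ 0) :
    Tendsto (fun N => ramanujanPartialSum N n) atTop (𝓝 ((r2 n : ℂ) / π)) := by
  have h : Tendsto (fun N => ∑ d ∈ n.divisors, chi4 d * chiMoebiusSum (2 * N / d)) atTop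
      (𝓝 (∑ d ∈ n.divisors, chi4 d * (4 / π))) := by
    refine tendsto_finsetSum _ fun d hd => Tendsto.const_mul _ (tendsto_chiMoebiusSum.comp ?_)
    have hd0 := Nat.pos_of_mem_divisors hd
    refine tendsto_atTop_atTop.2 fun b => ⟨b * d, fun N hN => ?_⟩
    rw [Nat.le_div_iff_mul_le hd0]
    omega
  have e : (r2 n : ℂ) / π = ∑ d ∈ n.divisors, chi4 d * (4 / π) := by
    have h2 : (r2 n : ℂ) = 4 * chiDivisorSum n := by
      exact_mod_cast r2_eq_four_mul_chiDivisorSum hn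
    rw [← Finset.sum_mul, sum_divisors_chi4, h2]
    ring
  rw [e]
  exact h.congr fun N => (ramanujanPartialSum_eq N n hn).symm

/-- The convergent Möbius sums are bounded and `n` has at most `n` divisors. This uniformity in `N`
is what dominated convergence needs. -/
theorem exists_norm_ramanujanPartialSum_le :
    ∃ C : ℝ, 0 ≤ C ∧ ∀ N n : ℕ, n ≠ 0 → ‖ramanujanPartialSum N n‖ ≤ C * n := by
  obtain ⟨C, hC⟩ := (Metric.isBounded_range_of_tendsto _ tendsto_chiMoebiusSum).exists_norm_le
  have hC' : ∀ N, ‖chiMoebiusSum N‖ ≤ C := fun N => hC _ ⟨N, rfl⟩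
  have hC0 : 0 ≤ C := (norm_nonneg _).trans (hC' 0)
  refine ⟨C, hC0, fun N n hn => ?_⟩
  rw [ramanujanPartialSum_eq N n hn]
  have h1 : ‖∑ d ∈ n.divisors, chi4 d * chiMoebiusSum (2 * N / d)‖ ≤ ∑ d ∈ n.divisors, C := by
    refine norm_sum_le_of_le _ fun d _ => ?_
    rw [norm_mul]
    calc _ ≤ 1 * C := mul_le_mul (chi4.norm_le_one _) (hC' _) (norm_nonneg _) zero_le_one
      _ = C := one_mul C
  refine h1.trans ?_
  rw [Finset.sum_const, nsmul_eq_mul, mul_comm]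
  gcongr
  exact Nat.card_divisors_le_self n

end CycProd

/-! ### Power series of the logarithms and the infinite products. -/

namespace CycProd

open Filter

/-- The Taylor series in z^q is spread over all exponents, so that the indicator of q ∣ m stands
where `hasSum_logPhiHat` has the Ramanujan sum. -/
theorem hasSum_log_one_sub_pow {z : ℂ} (hz : ‖z‖ < 1) {q : ℕ} (hq : q ≠ 0) :
    HasSum (fun m : ℕ => -(if q ∣ m then (q : ℂ) else 0) * (z ^ m / m)) (Complex.log (1 - z ^ q)) := by
  have hq' : (q : ℂ) ≠ 0 := by exact_mod_cast hq
  have hzq : ‖z ^ q‖ < 1 := by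
    rw [norm_pow]
    exact pow_lt_one₀ (norm_nonneg z) hz hq
  have h := (Complex.hasSum_taylorSeries_neg_log hzq).neg
  rw [neg_neg] at h
  have hinj : Function.Injective fun k : ℕ => q * k :=
    fun a b hab => Nat.eq_of_mul_eq_mul_left (Nat.pos_of_ne_zero hq) hab
  refine (hinj.hasSum_iff ?_).1 (h.congr_fun fun k => ?_)
  · intro m hm
    rw [if_neg, neg_zero, zero_mul]
    rintro ⟨k, rfl⟩
    exact hm ⟨k, rfl⟩
  · simp only [Function.comp]
    rw [if_pos (dvd_mul_right q k), ← pow_mul]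
    rcases eq_or_ne k 0 with rfl | hk
    · simp
    · have : (k : ℂ) ≠ 0 := by exact_mod_cast hk
      push_cast
      field_simp

theorem hasSum_logPhiHat (n : ℕ) {z : ℂ} (hz : ‖z‖ < 1) :
    HasSum (fun m : ℕ => -ramanujanSum n m * (z ^ m / m)) (logPhiHat n z) := by
  have h : ∀ k ∈ units n, HasSum (fun m : ℕ => -((z * zetaPow n k) ^ m / m))
      (Complex.log (1 - z * zetaPow n k)) := by
    intro k _
    have hk : ‖z * zetaPow n k‖ < 1 := by rwa [norm_mul, norm_zetaPow, mul_one]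
    simpa using (Complex.hasSum_taylorSeries_neg_log hk).neg
  refine (hasSum_sum h).congr_fun fun m => ?_
  rw [ramanujanSum, ← Finset.sum_neg_distrib, Finset.sum_mul]
  refine Finset.sum_congr rfl fun k _ => ?_
  rw [mul_pow, zetaPow, ← Complex.exp_nat_mul,
    show (m * (2 * π * Complex.I * k / n) : ℂ) = 2 * π * Complex.I * k * m / n by ring]
  ring

/-- Dominated convergence for series `∑ c_m z^m / m` with `c_m = O(m)`. -/
theorem tendsto_of_hasSum_mul_pow_div {z : ℂ} (hz : ‖z‖ < 1) {c : ℕ → ℕ → ℂ} {g : ℕ → ℂ}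
    {L : ℕ → ℂ} {C : ℝ} (hL : ∀ N, HasSum (fun m : ℕ => c N m * (z ^ m / m)) (L N))
    (hc : ∀ N m, m ≠ 0 → ‖c N m‖ ≤ C * m) (hC : 0 ≤ C)
    (hg : ∀ m, m ≠ 0 → Tendsto (fun N => c N m) atTop (𝓝 (g m))) :
    Tendsto L atTop (𝓝 (∑' m : ℕ, g m * (z ^ m / m))) := by
  have h : Tendsto (fun N => ∑' m : ℕ, c N m * (z ^ m / m)) atTop
      (𝓝 (∑' m : ℕ, g m * (z ^ m / m))) := by
    refine tendsto_tsum_of_dominated_convergence (bound := fun m : ℕ => C * ‖z‖ ^ m)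
      ((summable_geometric_of_lt_one (norm_nonneg z) hz).mul_left C) (fun m => ?_)
      (.of_forall fun N m => ?_)
    -- The term m = 0 vanishes because `z ^ 0 / 0 = 0`; in particular `r2 0 = 1` never enters the
    -- logarithm.
    · rcases eq_or_ne m 0 with rfl | hm
      · simp
      · exact (hg m hm).mul_const _
    · rcases eq_or_ne m 0 with rfl | hm
      · simpa using hC
      · have hm' : (0 : ℝ) < m := by exact_mod_cast Nat.pos_of_ne_zero hm
        rw [norm_mul, norm_div, norm_pow, Complex.norm_natCast]
        calc ‖c N m‖ * (‖z‖ ^ m / m) ≤ C * m * (‖z‖ ^ m / m) := by gcongr; exact hc N m hm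
          _ = C * ‖z‖ ^ m := by field_simp
  exact h.congr fun N => (hL N).tsum_eq

/-- The series `∑ r₂(m) z^m / m`, the logarithm of the infinite products. -/
noncomputable def r2LogSeries (z : ℂ) : ℂ := ∑' m : ℕ, (r2 m : ℂ) * (z ^ m / m)

theorem sum_neg_one_pow_ite_dvd (N : ℕ) {m : ℕ} (hm : m ≠ 0) :
    ∑ i ∈ Finset.range N, (-1 : ℂ) ^ i * (if 2 * i + 1 ∣ m then 1 else 0) =
      ∑ d ∈ m.divisors.filter (· ≤ 2 * N), chi4 d := by
  rw [← sum_Icc_chi4_mul (fun q => if q ∣ m then 1 else 0)]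
  simp_rw [mul_ite, mul_one, mul_zero]
  rw [← Finset.sum_filter]
  congr 1
  ext d
  simp only [Finset.mem_filter, Finset.mem_Icc, Nat.mem_divisors]
  constructor
  · rintro ⟨⟨h1, h2⟩, h3⟩
    exact ⟨⟨h3, hm⟩, h2⟩
  · rintro ⟨⟨h3, -⟩, h2⟩
    exact ⟨⟨Nat.pos_of_dvd_of_pos h3 (Nat.pos_of_ne_zero hm), h2⟩, h3⟩

/-- Each coefficient is a truncated divisor sum of χ₄, constant as soon as the truncation passes
`m`. -/
theorem tendsto_sum_log_one_sub_pow {z : ℂ} (hz : ‖z‖ < 1) :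
    Tendsto (fun N : ℕ => ∑ i ∈ Finset.range N,
      (-1 : ℂ) ^ (i + 1) * (Complex.log (1 - z ^ (2 * i + 1)) / (2 * i + 1))) atTop
      (𝓝 (r2LogSeries z / 4)) := by
  have h := tendsto_of_hasSum_mul_pow_div hz
    (c := fun N m => ∑ i ∈ Finset.range N, (-1 : ℂ) ^ i * (if 2 * i + 1 ∣ m then 1 else 0))
    (g := fun m => (r2 m : ℂ) / 4) (C := 1)
    (L := fun N : ℕ => ∑ i ∈ Finset.range N,
      (-1 : ℂ) ^ (i + 1) * (Complex.log (1 - z ^ (2 * i + 1)) / (2 * i + 1)))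
    (fun N => ?_) (fun N m hm => ?_) zero_le_one (fun m hm => ?_)
  · rw [r2LogSeries, ← tsum_div_const]
    simpa only [div_mul_eq_mul_div] using h
  · refine (hasSum_sum fun i _ => ((hasSum_log_one_sub_pow hz
      (Nat.succ_ne_zero (2 * i))).div_const (2 * i + 1 : ℂ)).mul_left
        ((-1) ^ (i + 1))).congr_fun fun m => ?_
    rw [Finset.sum_mul]
    refine Finset.sum_congr rfl fun i _ => ?_
    have : (2 * i + 1 : ℂ) ≠ 0 := by exact_mod_cast Nat.succ_ne_zero (2 * i)
    simp only [Nat.succ_eq_add_one]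
    split_ifs
    · push_cast
      field_simp
      ring
    · simp
  · rw [sum_neg_one_pow_ite_dvd N hm, one_mul]
    have h1 : ‖∑ d ∈ m.divisors.filter (· ≤ 2 * N), chi4 d‖ ≤
        ∑ d ∈ m.divisors.filter (· ≤ 2 * N), (1 : ℝ) :=
      norm_sum_le_of_le _ fun d _ => chi4.norm_le_one _
    refine h1.trans ?_
    rw [Finset.sum_const, nsmul_eq_mul, mul_one]
    exact_mod_cast (Finset.card_filter_le _ _).trans (Nat.card_divisors_le_self m)
  · refine tendsto_const_nhds.congr' ?_
    filter_upwards [eventually_ge_atTop m] with N hN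
    rw [sum_neg_one_pow_ite_dvd N hm, Finset.filter_true_of_mem, sum_divisors_chi4]
    · have : (r2 m : ℂ) = 4 * chiDivisorSum m := by exact_mod_cast r2_eq_four_mul_chiDivisorSum hm
      rw [this]
      ring
    · intro d hd
      have := Nat.divisor_le hd
      omega

theorem tendsto_sum_logPhiHat {z : ℂ} (hz : ‖z‖ < 1) :
    Tendsto (fun N : ℕ => ∑ i ∈ Finset.range N,
      (-1 : ℂ) ^ (i + 1) * (logPhiHat (2 * i + 1) z / (2 * i + 1))) atTop
      (𝓝 (r2LogSeries z / π)) := by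
  obtain ⟨C, hC0, hC⟩ := exists_norm_ramanujanPartialSum_le
  have h := tendsto_of_hasSum_mul_pow_div hz (c := ramanujanPartialSum)
    (g := fun m => (r2 m : ℂ) / π) (C := C)
    (L := fun N : ℕ => ∑ i ∈ Finset.range N,
      (-1 : ℂ) ^ (i + 1) * (logPhiHat (2 * i + 1) z / (2 * i + 1)))
    (fun N => ?_) hC hC0 (fun m hm => tendsto_ramanujanPartialSum hm)
  · rw [r2LogSeries, ← tsum_div_const]
    simpa only [div_mul_eq_mul_div] using h
  · refine (hasSum_sum fun i _ => ((hasSum_logPhiHat (2 * i + 1) hz).div_const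
      (2 * i + 1 : ℂ)).mul_left ((-1) ^ (i + 1))).congr_fun fun m => ?_
    rw [ramanujanPartialSum, Finset.sum_mul]
    refine Finset.sum_congr rfl fun i _ => ?_
    ring

/-- Consecutive terms are paired: even indices give 4i + 1 with sign -1, odd indices 4i + 3 with
sign +1. -/
theorem sum_range_two_mul_alternating (f : ℕ → ℂ) (N : ℕ) :
    ∑ i ∈ Finset.range (2 * N), (-1 : ℂ) ^ (i + 1) * (f (2 * i + 1) / (2 * i + 1)) =
      ∑ i ∈ Finset.range N, (f (4 * i + 3) / (4 * i + 3) - f (4 * i + 1) / (4 * i + 1)) := by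
  induction N with
  | zero => simp
  | succ N ih =>
    rw [show 2 * (N + 1) = 2 * N + 1 + 1 by ring, Finset.sum_range_succ, Finset.sum_range_succ, ih,
      Finset.sum_range_succ]
    have h1 : (-1 : ℂ) ^ (2 * N + 1) = -1 := by rw [pow_succ, pow_mul]; norm_num
    have h2 : (-1 : ℂ) ^ (2 * N + 1 + 1) = 1 := by rw [pow_succ, h1]; norm_num
    rw [h1, h2, show 2 * (2 * N) + 1 = 4 * N + 1 by ring,
      show 2 * (2 * N + 1) + 1 = 4 * N + 3 by ring]
    push_cast
    ring

theorem tendsto_paired_sum_log {z : ℂ} (hz : ‖z‖ < 1) :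
    Tendsto (fun N : ℕ => ∑ i ∈ Finset.range N,
      (4 / (4 * i + 3) * Complex.log (1 - z ^ (4 * i + 3)) -
        4 / (4 * i + 1) * Complex.log (1 - z ^ (4 * i + 1)))) atTop (𝓝 (r2LogSeries z)) := by
  have h := ((tendsto_sum_log_one_sub_pow hz).comp
    (tendsto_id.const_mul_atTop' (two_pos (α := ℕ)))).const_mul 4
  rw [mul_div_cancel₀ _ (show (4 : ℂ) ≠ 0 by norm_num)] at h
  refine h.congr fun N => ?_
  simp only [Function.comp, id]
  rw [sum_range_two_mul_alternating (fun q => Complex.log (1 - z ^ q)), Finset.mul_sum]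
  refine Finset.sum_congr rfl fun i _ => ?_
  ring

theorem tendsto_paired_sum_logPhiHat {z : ℂ} (hz : ‖z‖ < 1) :
    Tendsto (fun N : ℕ => ∑ i ∈ Finset.range N,
      (π / (4 * i + 3) * logPhiHat (4 * i + 3) z - π / (4 * i + 1) * logPhiHat (4 * i + 1) z))
      atTop (𝓝 (r2LogSeries z)) := by
  have hπ : (π : ℂ) ≠ 0 := by exact_mod_cast Real.pi_ne_zero
  have h := ((tendsto_sum_logPhiHat hz).comp
    (tendsto_id.const_mul_atTop' (two_pos (α := ℕ)))).const_mul (π : ℂ)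
  rw [mul_div_cancel₀ _ hπ] at h
  refine h.congr fun N => ?_
  simp only [Function.comp, id]
  rw [sum_range_two_mul_alternating (fun q => logPhiHat q z), Finset.mul_sum]
  refine Finset.sum_congr rfl fun i _ => ?_
  ring

theorem tendsto_prod_one_sub_pow {z : ℂ} (hz : ‖z‖ < 1) :
    Tendsto (fun N : ℕ => ∏ i ∈ Finset.range N,
      (1 - z ^ (4 * i + 3)) ^ (4 / (4 * i + 3) : ℂ) /
        (1 - z ^ (4 * i + 1)) ^ (4 / (4 * i + 1) : ℂ)) atTop
      (𝓝 (Complex.exp (r2LogSeries z))) := by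
  refine ((Complex.continuous_exp.tendsto _).comp (tendsto_paired_sum_log hz)).congr fun N => ?_
  have hne : ∀ q : ℕ, q ≠ 0 → 1 - z ^ q ≠ 0 := by
    intro q hq h
    have h1 : ‖z ^ q‖ < 1 := by
      rw [norm_pow]
      exact pow_lt_one₀ (norm_nonneg z) hz hq
    rw [← sub_eq_zero.1 h, norm_one] at h1
    exact lt_irrefl _ h1
  simp only [Function.comp]
  rw [Complex.exp_sum]
  refine Finset.prod_congr rfl fun i _ => ?_
  rw [Complex.exp_sub, Complex.cpow_def_of_ne_zero (hne _ (by omega)),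
    Complex.cpow_def_of_ne_zero (hne _ (by omega)), mul_comm (Complex.log _),
    mul_comm (Complex.log _)]

theorem tendsto_prod_phiHatPow {z : ℂ} (hz : ‖z‖ < 1) :
    Tendsto (fun N : ℕ => ∏ i ∈ Finset.range N,
      phiHatPow (4 * i + 3) (π / (4 * i + 3)) z / phiHatPow (4 * i + 1) (π / (4 * i + 1)) z) atTop
      (𝓝 (Complex.exp (r2LogSeries z))) := by
  refine ((Complex.continuous_exp.tendsto _).comp
    (tendsto_paired_sum_logPhiHat hz)).congr fun N => ?_
  simp only [Function.comp]
  rw [Complex.exp_sum]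
  refine Finset.prod_congr rfl fun i _ => ?_
  rw [Complex.exp_sub, phiHatPow, phiHatPow]

theorem r2_le {m : ℕ} (hm : m ≠ 0) : r2 m ≤ 4 * m := by
  have h1 : chiDivisorSum m ≤ m := by
    have : chiDivisorSum m ≤ ∑ d ∈ m.divisors, (1 : ℤ) := by
      refine Finset.sum_le_sum fun d _ => ?_
      generalize (d : ZMod 4) = x
      revert x
      decide
    refine this.trans ?_
    rw [Finset.sum_const, nsmul_eq_mul, mul_one]
    exact_mod_cast Nat.card_divisors_le_self m
  have h2 := r2_eq_four_mul_chiDivisorSum hm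
  omega

theorem norm_r2_mul_pow_div_le {w : ℂ} {r : ℝ} (hw : ‖w‖ ≤ r) (m : ℕ) :
    ‖(r2 m : ℂ) * (w ^ m / m)‖ ≤ 4 * r ^ m := by
  have hr : 0 ≤ r := (norm_nonneg w).trans hw
  rcases eq_or_ne m 0 with rfl | hm
  · simp
  · have hm' : (0 : ℝ) < m := by exact_mod_cast Nat.pos_of_ne_zero hm
    have h : (r2 m : ℝ) ≤ 4 * m := by exact_mod_cast r2_le hm
    rw [norm_mul, norm_div, norm_pow, Complex.norm_natCast, Complex.norm_natCast]
    calc (r2 m : ℝ) * (‖w‖ ^ m / m) ≤ 4 * m * (r ^ m / m) := by gcongr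
      _ = 4 * r ^ m := by field_simp

theorem exists_radius {z : ℂ} (hz : ‖z‖ < 1) :
    ∃ r : ℝ, z ∈ Metric.ball (0 : ℂ) r ∧ Summable fun m : ℕ => 4 * r ^ m := by
  obtain ⟨r, h1, h2⟩ := exists_between hz
  exact ⟨r, by simpa using h1,
    (summable_geometric_of_lt_one ((norm_nonneg z).trans h1.le) h2).mul_left 4⟩

theorem differentiableOn_r2LogSeries : DifferentiableOn ℂ r2LogSeries (Metric.ball 0 1) := by
  intro z hz
  obtain ⟨r, hr, hs⟩ := exists_radius (z := z) (by simpa using hz)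
  refine DifferentiableAt.differentiableWithinAt ?_
  refine (Complex.differentiableOn_tsum_of_summable_norm (U := Metric.ball 0 r) hs ?_
    Metric.isOpen_ball ?_).differentiableAt (Metric.isOpen_ball.mem_nhds hr)
  · exact fun m => by fun_prop
  · exact fun m w hw => norm_r2_mul_pow_div_le (mem_ball_zero_iff.1 hw).le m

theorem hasSum_mul_deriv_r2LogSeries {z : ℂ} (hz : ‖z‖ < 1) :
    HasSum (fun n : ℕ => (r2 (n + 1) : ℂ) * z ^ (n + 1)) (z * deriv r2LogSeries z) := by
  obtain ⟨r, hr, hs⟩ := exists_radius hz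
  have h := Complex.hasSum_deriv_of_summable_norm (U := Metric.ball 0 r)
    (F := fun m w => (r2 m : ℂ) * (w ^ m / m)) hs (fun m => by fun_prop)
    Metric.isOpen_ball (fun m w hw => norm_r2_mul_pow_div_le (mem_ball_zero_iff.1 hw).le m) hr
  have h2 := (hasSum_nat_add_iff' 1).2 (h.mul_left z)
  have e : ∀ m : ℕ, z * deriv (fun w : ℂ => (r2 m : ℂ) * (w ^ m / m)) z =
      if m = 0 then 0 else (r2 m : ℂ) * z ^ m := by
    intro m
    rw [deriv_const_mul_field, deriv_div_const, deriv_pow_field]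
    rcases m with - | k
    · simp
    · have hm' : ((k + 1 : ℕ) : ℂ) ≠ 0 := by exact_mod_cast Nat.succ_ne_zero k
      rw [if_neg (Nat.succ_ne_zero k), Nat.add_sub_cancel, pow_succ]
      field_simp
  simp only [e] at h2
  rw [show r2LogSeries = fun w => ∑' m : ℕ, (r2 m : ℂ) * (w ^ m / m) from rfl]
  simpa using h2

/-- The absolutely convergent double series over ℤ² is regrouped along the circles x² + y² = n. -/
theorem hasSum_theta_sq {z : ℂ} (hz : ‖z‖ < 1) :
    HasSum (fun n : ℕ => (r2 n : ℂ) * z ^ n) (theta z ^ 2) := by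
  have hθ := hasSum_theta (z := z) (by simpa using hz)
  have hn : Summable fun n : ℤ => ‖z ^ (n.natAbs ^ 2)‖ := hθ.summable.norm
  have h2 : HasSum (fun p : ℤ × ℤ => z ^ (p.1.natAbs ^ 2) * z ^ (p.2.natAbs ^ 2)) (theta z ^ 2) := by
    have key : ∀ (f : ℤ → ℂ) (s : ℂ), HasSum f s → Summable (fun n => ‖f n‖) →
        HasSum (fun p : ℤ × ℤ => f p.1 * f p.2) (s ^ 2) := fun f s hf hfn => by
      rw [sq]
      exact hf.mul hf (summable_mul_of_summable_norm hfn hfn)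
    exact key (fun n : ℤ => z ^ (n.natAbs ^ 2)) _ hθ hn
  let φ : ℤ × ℤ → ℕ := fun p => p.1.natAbs ^ 2 + p.2.natAbs ^ 2
  refine (h2.tsum_fiberwise φ).congr_fun fun n => ?_
  have hset : φ ⁻¹' {n} = circlePoints n := by
    ext p
    simp only [φ, circlePoints, Set.mem_preimage, Set.mem_singleton_iff, Set.mem_ofPred_eq]
    rw [← Int.natAbs_sq p.1, ← Int.natAbs_sq p.2]
    exact_mod_cast Iff.rfl
  have h5 : ∀ p : φ ⁻¹' {n},
      z ^ (p.1.1.natAbs ^ 2) * z ^ (p.1.2.natAbs ^ 2) = z ^ n := by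
    rintro ⟨p, hp⟩
    rw [← pow_add]
    exact congrArg _ hp
  rw [tsum_congr h5, tsum_const, hset, nsmul_eq_mul]
  rfl

theorem one_add_mul_deriv_r2LogSeries {z : ℂ} (hz : ‖z‖ < 1) :
    1 + z * deriv r2LogSeries z = theta z ^ 2 := by
  have h := (hasSum_nat_add_iff' 1).2 (hasSum_theta_sq hz)
  have h2 := (hasSum_mul_deriv_r2LogSeries hz).unique h
  rw [h2]
  simp [r2_zero]

theorem logDeriv_exp_r2LogSeries {z : ℂ} (hz : ‖z‖ < 1) :
    logDeriv (fun w => Complex.exp (r2LogSeries w)) z = deriv r2LogSeries z := by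
  have hd : DifferentiableAt ℂ r2LogSeries z :=
    differentiableOn_r2LogSeries.differentiableAt (Metric.isOpen_ball.mem_nhds (by simpa using hz))
  rw [logDeriv_apply, deriv_cexp hd, mul_div_cancel_left₀ _ (Complex.exp_ne_zero _)]

/-- By the identity theorem it suffices that the series is not identically zero. If it were, its
derivative at 1/2 would vanish, but there all terms are nonnegative and r₂(1) = 4. -/
theorem eventually_codiscreteWithin_r2LogSeries_ne_zero :
    ∀ᶠ z in codiscreteWithin (Metric.ball (0 : ℂ) 1), r2LogSeries z ≠ 0 := by
  have han : AnalyticOnNhd ℂ r2LogSeries (Metric.ball 0 1) :=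
    differentiableOn_r2LogSeries.analyticOnNhd Metric.isOpen_ball
  obtain ⟨x, hx, hne⟩ : ∃ x ∈ Metric.ball (0 : ℂ) 1, r2LogSeries x ≠ 0 := by
    by_contra! h0
    have hd : ∀ z ∈ Metric.ball (0 : ℂ) 1, deriv r2LogSeries z = 0 := by
      intro z hz
      have : r2LogSeries =ᶠ[𝓝 z] fun _ => 0 := by
        filter_upwards [Metric.isOpen_ball.mem_nhds hz] with w hw using h0 w hw
      rw [this.deriv_eq, deriv_const]
    have hz : ‖(1 / 2 : ℂ)‖ < 1 := by norm_num
    have h1 := hasSum_mul_deriv_r2LogSeries hz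
    rw [hd _ (by simpa using hz), mul_zero] at h1
    have h2 : HasSum (fun n : ℕ => (r2 (n + 1) : ℝ) * (1 / 2) ^ (n + 1)) 0 := by
      rw [← Complex.hasSum_ofReal]
      simpa using h1
    have h3 := (hasSum_zero_iff_of_nonneg (fun n => by positivity)).1 h2
    have h4 := congrFun h3 0
    simp [r2_one] at h4
  have hconn : IsConnected (Metric.ball (0 : ℂ) 1) :=
    (convex_ball (0 : ℂ) 1).isConnected ⟨0, Metric.mem_ball_self one_pos⟩
  exact han.preimage_zero_mem_codiscreteWithin hne hx hconn

end CycProd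

/-! ### Modularity of θ² on Γ₀(4). -/

namespace CycProd

open Filter CongruenceSubgroup Matrix ModularForm

/-- Squaring removes the square root from the inversion formula. -/
theorem jacobiTheta_neg_inv_sq {τ : ℂ} (hτ : 0 < τ.im) :
    jacobiTheta (-1 / τ) ^ 2 = -Complex.I * τ * jacobiTheta τ ^ 2 := by
  have h := jacobiTheta_S_smul ⟨τ, hτ⟩
  have hS : ((ModularGroup.S • (⟨τ, hτ⟩ : ℍ) : ℍ) : ℂ) = -1 / τ := by
    rw [UpperHalfPlane.modular_S_smul]
    change (-τ)⁻¹ = -1 / τ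
    rw [inv_neg, neg_div, one_div]
  rw [hS] at h
  rw [h, mul_pow, ← Complex.cpow_nat_mul]
  norm_num

/-- The square of `θ(e^{2πiτ})`. -/
noncomputable def thetaSq (τ : ℂ) : ℂ := jacobiTheta (2 * τ) ^ 2

theorem two_mul_im_pos {τ : ℂ} (hτ : 0 < τ.im) : 0 < (2 * τ).im := by
  simpa using hτ

theorem theta_exp_sq (τ : ℂ) : theta (Complex.exp (2 * π * Complex.I * τ)) ^ 2 = thetaSq τ := by
  rw [thetaSq, theta, jacobiTheta]
  congr 1
  refine tsum_congr fun n => ?_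
  rw [← Complex.exp_nat_mul]
  congr 1
  have : ((n.natAbs ^ 2 : ℕ) : ℂ) = (n : ℂ) ^ 2 := by
    have h : ((n.natAbs ^ 2 : ℕ) : ℤ) = n ^ 2 := by
      push_cast
      exact sq_abs n
    rw [← Int.cast_natCast, h, Int.cast_pow]
  rw [this]
  ring

theorem thetaSq_add_one (τ : ℂ) : thetaSq (τ + 1) = thetaSq τ := by
  rw [thetaSq, thetaSq, show 2 * (τ + 1) = 2 + 2 * τ by ring, jacobiTheta_two_add]

theorem thetaSq_sub_one (τ : ℂ) : thetaSq (τ - 1) = thetaSq τ := by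
  rw [← thetaSq_add_one, sub_add_cancel]

theorem thetaSq_neg_inv {τ : ℂ} (hτ : 0 < τ.im) :
    thetaSq (-1 / (4 * τ)) = -2 * Complex.I * τ * thetaSq τ := by
  have h := jacobiTheta_neg_inv_sq (two_mul_im_pos hτ)
  have hτ0 : τ ≠ 0 := by rintro rfl; simp at hτ
  rw [thetaSq, thetaSq, show 2 * (-1 / (4 * τ)) = -1 / (2 * τ) by field_simp; norm_num, h]
  ring

/-- The involution τ ↦ -1/(4τ) conjugates τ ↦ τ/(4τ + 1) to translation by -1, so two inversions and
periodicity suffice. -/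
theorem thetaSq_div {τ w : ℂ} (hτ : 0 < τ.im) (hw : 0 < w.im) (h : w * (4 * τ + 1) = τ) :
    thetaSq w = (4 * τ + 1) * thetaSq τ := by
  have hτ0 : τ ≠ 0 := by rintro rfl; simp at hτ
  have hw0 : w ≠ 0 := by rintro rfl; simp at hw
  have h1 := thetaSq_neg_inv hτ
  have h2 := thetaSq_neg_inv hw
  have e : -1 / (4 * w) = -1 / (4 * τ) - 1 := by
    field_simp
    linear_combination h
  rw [e, thetaSq_sub_one, h1] at h2
  have h3 : (-2 * Complex.I * w : ℂ) ≠ 0 := by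
    simp [hw0]
  refine mul_left_cancel₀ h3 ?_
  rw [← h2]
  linear_combination (2 * Complex.I * thetaSq τ) * h

/-- The function `θ²` on the upper half plane. -/
noncomputable def thetaSqFun (τ : ℍ) : ℂ := thetaSq τ

/-- The matrix `(1, 0; 4, 1)`. -/
def lowerFour : SpecialLinearGroup (Fin 2) ℤ := ⟨!![1, 0; 4, 1], by simp⟩

theorem coe_lowerFour : (lowerFour : Matrix (Fin 2) (Fin 2) ℤ) = !![1, 0; 4, 1] := rfl

theorem thetaSqFun_slash_T : thetaSqFun ∣[(1 : ℤ)] ModularGroup.T = thetaSqFun := by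
  ext τ
  rw [slash_action_eq'_iff]
  have h : ((ModularGroup.T • τ : ℍ) : ℂ) = τ + 1 := by
    rw [UpperHalfPlane.specialLinearGroup_apply]
    simp [ModularGroup.T]
  rw [thetaSqFun, thetaSqFun, h, thetaSq_add_one]
  simp [ModularGroup.T]

theorem thetaSqFun_slash_lowerFour : thetaSqFun ∣[(1 : ℤ)] lowerFour = thetaSqFun := by
  ext τ
  rw [slash_action_eq'_iff]
  have hne : (4 * (τ : ℂ) + 1) ≠ 0 := by
    intro h
    have h1 := congrArg Complex.im h
    have h2 : 0 < (τ : ℂ).im := τ.2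
    simp at h1
    exact h2.ne' h1
  have h : ((lowerFour • τ : ℍ) : ℂ) = τ / (4 * τ + 1) := by
    rw [UpperHalfPlane.specialLinearGroup_apply]
    simp [lowerFour]
  rw [thetaSqFun, thetaSqFun, thetaSq_div τ.2 (lowerFour • τ).2 (by rw [h, div_mul_cancel₀ _ hne])]
  simp [lowerFour]

theorem thetaSqFun_slash_neg_one :
    thetaSqFun ∣[(1 : ℤ)] (-1 : SpecialLinearGroup (Fin 2) ℤ) = -thetaSqFun := by
  ext τ
  rw [SL_slash_apply, ModularGroup.SL_neg_smul, one_smul]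
  simp [UpperHalfPlane.denom]

/-- The value of the character `χ₄` on the lower right entry. -/
def charFour (γ : SpecialLinearGroup (Fin 2) ℤ) : ℤ := ZMod.χ₄ (γ 1 1 : ZMod 4)

/-- The lower left entry of `γ` vanishes modulo 4, so lower right entries multiply. -/
theorem charFour_mul {γ δ : SpecialLinearGroup (Fin 2) ℤ} (hγ : γ ∈ Gamma0 4) :
    charFour (γ * δ) = charFour γ * charFour δ := by
  rw [Gamma0_mem] at hγ
  rw [charFour, charFour, charFour, ← map_mul]
  congr 1
  simp [Matrix.mul_apply, Fin.sum_univ_two, hγ]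

/-- The elements of `Γ₀(4)` that act on `θ²` through the character `χ₄`. -/
def thetaStabilizer : Subgroup (SpecialLinearGroup (Fin 2) ℤ) where
  carrier := {γ | γ ∈ Gamma0 4 ∧ thetaSqFun ∣[(1 : ℤ)] γ = charFour γ • thetaSqFun}
  one_mem' := ⟨Subgroup.one_mem _, by simp [charFour]⟩
  mul_mem' := by
    rintro γ δ ⟨hγ, eγ⟩ ⟨hδ, eδ⟩
    refine ⟨Subgroup.mul_mem _ hγ hδ, ?_⟩
    rw [SlashAction.slash_mul, eγ, SL_smul_slash, eδ, charFour_mul hγ, mul_smul]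
  inv_mem' := by
    rintro γ ⟨hγ, eγ⟩
    refine ⟨Subgroup.inv_mem _ hγ, ?_⟩
    have h1 : charFour γ * charFour γ⁻¹ = 1 := by
      rw [← charFour_mul hγ, mul_inv_cancel]
      simp [charFour]
    have h2 : thetaSqFun = charFour γ • (thetaSqFun ∣[(1 : ℤ)] γ⁻¹) := by
      rw [← SL_smul_slash, ← eγ, ← SlashAction.slash_mul, mul_inv_cancel, SlashAction.slash_one]
    nth_rewrite 2 [h2]
    rw [← mul_smul, mul_comm, h1, one_smul]

theorem T_mem_thetaStabilizer : ModularGroup.T ∈ thetaStabilizer :=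
  ⟨by rw [Gamma0_mem]; simp [ModularGroup.T], by
    rw [thetaSqFun_slash_T]
    simp [charFour, ModularGroup.T]⟩

theorem lowerFour_mem_thetaStabilizer : lowerFour ∈ thetaStabilizer :=
  ⟨by rw [Gamma0_mem]; simp [lowerFour]; rfl, by
    rw [thetaSqFun_slash_lowerFour]
    simp [charFour, lowerFour]⟩

theorem neg_one_mem_thetaStabilizer : -1 ∈ thetaStabilizer :=
  ⟨by simp [Gamma0_mem], by
    rw [thetaSqFun_slash_neg_one]
    have : charFour (-1) = -1 := by
      rw [charFour]
      simp
      decide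
    rw [this, neg_one_smul]⟩

theorem mem_thetaStabilizer_of_lower_left_eq_zero {γ : SpecialLinearGroup (Fin 2) ℤ}
    (h : γ 1 0 = 0) : γ ∈ thetaStabilizer := by
  have hdet := γ.det_coe
  rw [Matrix.det_fin_two, h, mul_zero, sub_zero] at hdet
  rcases Int.eq_one_or_neg_one_of_mul_eq_one' hdet with ⟨ha, hd⟩ | ⟨ha, hd⟩
  · have e : γ = ModularGroup.T ^ (γ 0 1) := by
      ext i j
      rw [ModularGroup.coe_T_zpow]
      fin_cases i <;> fin_cases j <;> simp [h, ha, hd]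
    rw [e]
    exact Subgroup.zpow_mem _ T_mem_thetaStabilizer _
  · have e : γ = -1 * ModularGroup.T ^ (-γ 0 1) := by
      ext i j
      rw [neg_one_mul, SpecialLinearGroup.coe_neg, ModularGroup.coe_T_zpow]
      fin_cases i <;> fin_cases j <;> simp [h, ha, hd]
    rw [e]
    exact Subgroup.mul_mem _ neg_one_mem_thetaStabilizer
      (Subgroup.zpow_mem _ T_mem_thetaStabilizer _)

/-- `Γ₀(4)` is generated by `-1`, `T` and `(1, 0; 4, 1)`. -/
theorem Gamma0_four_le_thetaStabilizer : Gamma0 4 ≤ thetaStabilizer := by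
  -- Euclidean descent on the bottom row (c, d): right multiplication by T^k replaces d by d + kc,
  -- and by `lowerFour` or its inverse c by c ± 4d.
  have key : ∀ n : ℕ, ∀ γ ∈ Gamma0 4, (γ 1 0).natAbs + (γ 1 1).natAbs = n →
      γ ∈ thetaStabilizer := by
    intro n
    induction n using Nat.strong_induction_on with
    | _ n ih =>
      intro γ hγ hn
      by_cases hc : γ 1 0 = 0
      · exact mem_thetaStabilizer_of_lower_left_eq_zero hc
      have h4 : (4 : ℤ) ∣ γ 1 0 := by
        have := Gamma0_mem.1 hγ
        exact_mod_cast (ZMod.intCast_zmod_eq_zero_iff_dvd _ 4).1 this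
      have hdet := γ.det_coe
      rw [Matrix.det_fin_two] at hdet
      have hodd : γ 1 1 % 2 = 1 := by
        obtain ⟨k, hk⟩ := h4
        by_contra hne
        have h0 : γ 1 1 % 2 = 0 := by omega
        obtain ⟨l, hl⟩ := Int.dvd_of_emod_eq_zero h0
        rw [hk, hl] at hdet
        have : 2 * (γ 0 0 * l - γ 0 1 * (2 * k)) = 1 := by linear_combination hdet
        omega
      have step : ∀ δ ∈ thetaStabilizer,
          ((γ * δ) 1 0).natAbs + ((γ * δ) 1 1).natAbs < n → γ ∈ thetaStabilizer := by
        intro δ hδ hlt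
        have h1 := ih _ hlt (γ * δ) (Subgroup.mul_mem _ hγ hδ.1) rfl
        exact (Subgroup.mul_mem_cancel_right _ hδ).1 h1
      have eT : ∀ k : ℤ, (γ * ModularGroup.T ^ k) 1 0 = γ 1 0 ∧
          (γ * ModularGroup.T ^ k) 1 1 = γ 1 0 * k + γ 1 1 := by
        intro k
        simp [ModularGroup.coe_T_zpow, Matrix.mul_apply, Fin.sum_univ_two]
      have eV : (γ * lowerFour) 1 0 = γ 1 0 + γ 1 1 * 4 ∧ (γ * lowerFour) 1 1 = γ 1 1 := by
        simp [coe_lowerFour, Matrix.mul_apply, Fin.sum_univ_two]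
      have eV' : (γ * lowerFour⁻¹) 1 0 = γ 1 0 - γ 1 1 * 4 ∧
          (γ * lowerFour⁻¹) 1 1 = γ 1 1 := by
        constructor <;> simp [coe_lowerFour, Matrix.mul_apply, Fin.sum_univ_two, sub_eq_add_neg]
      obtain ⟨k, hk⟩ := h4
      -- Equality |c| = 2|d| is impossible as 4 ∣ c and d is odd. If |c| < 2|d|, a shift of d by ±c
      -- shrinks |d|; if |c| > 2|d|, a shift of c by ±4d shrinks |c|.
      rcases lt_or_gt_of_ne (show (γ 1 0).natAbs ≠ 2 * (γ 1 1).natAbs by omega) with h | h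
      · rcases le_or_gt 0 (γ 1 0 * γ 1 1) with hs | hs
        · refine step (ModularGroup.T ^ (-1 : ℤ)) (Subgroup.zpow_mem _ T_mem_thetaStabilizer _) ?_
          rw [(eT (-1)).1, (eT (-1)).2]
          rcases pos_and_pos_or_neg_and_neg_of_mul_pos
            (lt_of_le_of_ne hs (mul_ne_zero hc (by omega)).symm) with ⟨h1, h2⟩ | ⟨h1, h2⟩ <;> omega
        · refine step (ModularGroup.T ^ (1 : ℤ)) (Subgroup.zpow_mem _ T_mem_thetaStabilizer _) ?_
          rw [(eT 1).1, (eT 1).2]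
          rcases mul_neg_iff.1 hs with ⟨h1, h2⟩ | ⟨h1, h2⟩ <;> omega
      · rcases le_or_gt 0 (γ 1 0 * γ 1 1) with hs | hs
        · refine step lowerFour⁻¹ (Subgroup.inv_mem _ lowerFour_mem_thetaStabilizer) ?_
          rw [eV'.1, eV'.2]
          rcases pos_and_pos_or_neg_and_neg_of_mul_pos
            (lt_of_le_of_ne hs (mul_ne_zero hc (by omega)).symm) with ⟨h1, h2⟩ | ⟨h1, h2⟩ <;> omega
        · refine step lowerFour lowerFour_mem_thetaStabilizer ?_
          rw [eV.1, eV.2]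
          rcases mul_neg_iff.1 hs with ⟨h1, h2⟩ | ⟨h1, h2⟩ <;> omega
  exact fun γ hγ => key _ γ hγ rfl

theorem thetaSqFun_slash_of_mem_Gamma1 {γ : SpecialLinearGroup (Fin 2) ℤ} (hγ : γ ∈ Gamma1 4) :
    thetaSqFun ∣[(1 : ℤ)] γ = thetaSqFun := by
  rw [(Gamma0_four_le_thetaStabilizer (Gamma1_in_Gamma0 4 hγ)).2, charFour,
    ((Gamma1_mem 4 γ).1 hγ).2.1, map_one, one_smul]

theorem thetaSqFun_smul {γ : SpecialLinearGroup (Fin 2) ℤ} (hγ : γ ∈ Gamma0 4) (τ : ℍ) :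
    thetaSqFun (γ • τ) = ((ZMod.χ₄ (γ 1 1 : ZMod 4) : ℤ) : ℂ) *
      ((γ 1 0 : ℂ) * (τ : ℂ) + (γ 1 1 : ℂ)) * thetaSqFun τ := by
  have h := congrFun (Gamma0_four_le_thetaStabilizer hγ).2 τ
  rw [SL_slash_apply] at h
  have hd : UpperHalfPlane.denom γ τ = (γ 1 0 : ℂ) * (τ : ℂ) + (γ 1 1 : ℂ) := by
    simp [UpperHalfPlane.denom]
  have hne := UpperHalfPlane.denom_ne_zero γ τ
  rw [_root_.zpow_neg_one, ← div_eq_mul_inv, div_eq_iff hne, hd] at h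
  rw [h, Pi.smul_apply, zsmul_eq_mul, charFour]
  ring

/-- Triangle inequality: on the imaginary axis every term is positive and equals the absolute value
of the term at `τ`. -/
theorem norm_jacobiTheta_le (τ : ℂ) (hτ : 0 < τ.im) :
    ‖jacobiTheta τ‖ ≤ ‖jacobiTheta (Complex.I * τ.im)‖ := by
  have hI : 0 < (Complex.I * τ.im : ℂ).im := by simpa using hτ
  have e : ∀ n : ℤ, Complex.exp (π * Complex.I * (n : ℂ) ^ 2 * (Complex.I * τ.im)) =
      ((Real.exp (-π * n ^ 2 * τ.im) : ℝ) : ℂ) := by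
    intro n
    rw [Complex.ofReal_exp]
    congr 1
    push_cast
    linear_combination (π * (n : ℂ) ^ 2 * τ.im) * Complex.I_mul_I
  have e2 : ∀ n : ℤ, ‖Complex.exp (π * Complex.I * (n : ℂ) ^ 2 * τ)‖ =
      Real.exp (-π * n ^ 2 * τ.im) := by
    intro n
    rw [Complex.norm_exp]
    congr 1
    have : (π * Complex.I * (n : ℂ) ^ 2 * τ) = ((π * n ^ 2 : ℝ) : ℂ) * (Complex.I * τ) := by
      push_cast; ring
    rw [this, Complex.re_ofReal_mul]
    simp
  have hs : Summable fun n : ℤ => Real.exp (-π * n ^ 2 * τ.im) := by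
    have h1 := (hasSum_jacobiTheta₂_term 0 hτ).summable.norm
    refine h1.congr fun n => ?_
    rw [← e2 n]
    simp [jacobiTheta₂_term]
  rw [jacobiTheta, jacobiTheta]
  simp_rw [e]
  rw [← Complex.ofReal_tsum, Complex.norm_real]
  refine (norm_tsum_le_tsum_norm (by simpa only [e2] using hs)).trans ?_
  simp_rw [e2]
  exact Real.le_norm_self _

/-- For Im τ ≥ 1 the theta series is bounded. For smaller y = Im τ, compare with the point iy and
invert to i/y, which costs the factor 1/y. -/
theorem exists_norm_jacobiTheta_sq_le :
    ∃ C : ℝ, 0 ≤ C ∧ ∀ τ : ℂ, 0 < τ.im → ‖jacobiTheta τ ^ 2‖ ≤ C * (1 + 1 / τ.im) := by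
  have hexp : Real.exp (-π) < 1 := by
    rw [Real.exp_lt_one_iff]
    exact neg_lt_zero.2 Real.pi_pos
  set M : ℝ := 1 + 2 / (1 - Real.exp (-π)) with hM
  have hM1 : 0 ≤ M := by
    have : 0 < 1 - Real.exp (-π) := by linarith
    positivity
  have hlarge : ∀ τ : ℂ, 1 ≤ τ.im → ‖jacobiTheta τ ^ 2‖ ≤ M ^ 2 := by
    intro τ hτ
    rw [norm_pow]
    refine pow_le_pow_left₀ (norm_nonneg _) ?_ 2
    have h1 := norm_jacobiTheta_sub_one_le (τ := τ) (by linarith)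
    have h2 : Real.exp (-π * τ.im) ≤ Real.exp (-π) := by
      refine Real.exp_le_exp.2 ?_
      nlinarith [Real.pi_pos]
    have h3 : 2 / (1 - Real.exp (-π * τ.im)) * Real.exp (-π * τ.im) ≤ 2 / (1 - Real.exp (-π)) := by
      calc _ ≤ 2 / (1 - Real.exp (-π)) * 1 :=
            mul_le_mul (div_le_div_of_nonneg_left two_pos.le (by linarith) (by linarith))
              (by linarith) (Real.exp_pos _).le (div_nonneg two_pos.le (by linarith))
        _ = _ := mul_one _
    have h4 : ‖jacobiTheta τ‖ ≤ ‖jacobiTheta τ - 1‖ + 1 := by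
      simpa using norm_add_le (jacobiTheta τ - 1) 1
    linarith
  refine ⟨M ^ 2, by positivity, fun τ hτ => ?_⟩
  have hpos : 0 < 1 / τ.im := by positivity
  rcases le_or_gt 1 τ.im with h | h
  · refine (hlarge τ h).trans ?_
    nlinarith [sq_nonneg M]
  · have h1 : ‖jacobiTheta τ ^ 2‖ ≤ ‖jacobiTheta (Complex.I * τ.im) ^ 2‖ := by
      rw [norm_pow, norm_pow]
      exact pow_le_pow_left₀ (norm_nonneg _) (norm_jacobiTheta_le τ hτ) 2
    have him : (Complex.I * ((1 / τ.im : ℝ) : ℂ)).im = 1 / τ.im := by simp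
    have h2 := jacobiTheta_neg_inv_sq (τ := Complex.I * ((1 / τ.im : ℝ) : ℂ)) (by rw [him]; exact hpos)
    have hτc : (τ.im : ℂ) ≠ 0 := by exact_mod_cast hτ.ne'
    have e : -1 / (Complex.I * ((1 / τ.im : ℝ) : ℂ)) = Complex.I * τ.im := by
      push_cast
      field_simp
      rw [Complex.I_sq]
    rw [e] at h2
    rw [h2] at h1
    refine h1.trans ?_
    have h3 := hlarge (Complex.I * ((1 / τ.im : ℝ) : ℂ)) (by
      rw [him, le_div_iff₀ hτ]; linarith)
    rw [norm_mul, norm_mul, norm_mul, norm_neg, Complex.norm_I, Complex.norm_real, one_mul, one_mul,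
      Real.norm_of_nonneg hpos.le]
    calc 1 / τ.im * _ ≤ 1 / τ.im * M ^ 2 := by gcongr
      _ ≤ _ := by nlinarith [sq_nonneg M]

theorem exists_norm_thetaSqFun_le :
    ∃ C : ℝ, 0 ≤ C ∧ ∀ τ : ℍ, ‖thetaSqFun τ‖ ≤ C * (1 + 1 / τ.im) := by
  obtain ⟨C, hC0, hC⟩ := exists_norm_jacobiTheta_sq_le
  refine ⟨C, hC0, fun τ => (hC (2 * τ) (two_mul_im_pos τ.2)).trans ?_⟩
  have h : (2 * (τ : ℂ)).im = 2 * τ.im := by simp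
  have := τ.im_pos
  rw [h]
  gcongr
  linarith

/-- Γ(4) is normal and contained in Γ₁(4), so γT^{4k}γ⁻¹ fixes θ². The resulting period 4 reduces
boundedness at infinity to a strip. -/
theorem thetaSqFun_slash_slash_T_zpow (γ : SpecialLinearGroup (Fin 2) ℤ) (k : ℤ) :
    (thetaSqFun ∣[(1 : ℤ)] γ) ∣[(1 : ℤ)] (ModularGroup.T ^ (4 * k)) = thetaSqFun ∣[(1 : ℤ)] γ := by
  have hT : ModularGroup.T ^ (4 * k) ∈ Gamma 4 :=
    ModularGroup_T_pow_mem_Gamma 4 (4 * k) (dvd_mul_right _ _)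
  have hc : γ * ModularGroup.T ^ (4 * k) * γ⁻¹ ∈ Gamma 4 := (Gamma_normal 4).conj_mem _ hT γ
  have h1 : γ * ModularGroup.T ^ (4 * k) * γ⁻¹ ∈ Gamma1 4 := by
    rw [Gamma_mem] at hc
    rw [Gamma1_mem]
    exact ⟨hc.1, hc.2.2.2, hc.2.2.1⟩
  rw [← SlashAction.slash_mul, show γ * ModularGroup.T ^ (4 * k) =
    γ * ModularGroup.T ^ (4 * k) * γ⁻¹ * γ by group, SlashAction.slash_mul,
    thetaSqFun_slash_of_mem_Gamma1 h1]

/-- With j = cτ + d and Im γτ = y/|j|², the growth bound gives C(1/|j| + |j|/y). Here |j| ≥ 1, as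
(c, d) is a nonzero integer row and y ≥ 1, while |j| = O(y) on the strip. -/
theorem thetaSqFun_slash_bounded_strip (γ : SpecialLinearGroup (Fin 2) ℤ) :
    ∃ M : ℝ, ∀ τ : ℍ, 1 ≤ τ.im → |τ.re| ≤ 4 → ‖(thetaSqFun ∣[(1 : ℤ)] γ) τ‖ ≤ M := by
  obtain ⟨C, hC0, hC⟩ := exists_norm_thetaSqFun_le
  refine ⟨C * (1 + (5 * |(γ 1 0 : ℝ)| + |(γ 1 1 : ℝ)|)), fun τ hy hx => ?_⟩
  have hd : UpperHalfPlane.denom γ τ = (γ 1 0 : ℂ) * (τ : ℂ) + (γ 1 1 : ℂ) := by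
    simp [UpperHalfPlane.denom]
  set j : ℂ := UpperHalfPlane.denom γ τ with hj
  have hy0 : 0 < τ.im := τ.im_pos
  have hsq : ‖j‖ ^ 2 = ((γ 1 0 : ℝ) * τ.re + γ 1 1) ^ 2 + ((γ 1 0 : ℝ) * τ.im) ^ 2 := by
    rw [← Complex.normSq_eq_norm_sq, hd, Complex.normSq_apply]
    simp
    ring
  have hj1 : 1 ≤ ‖j‖ := by
    have : 1 ≤ ‖j‖ ^ 2 := by
      rw [hsq]
      by_cases hc : γ 1 0 = 0
      · have hdet := γ.det_coe
        rw [Matrix.det_fin_two, hc, mul_zero, sub_zero] at hdet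
        have hd0 : γ 1 1 ≠ 0 := right_ne_zero_of_mul (by rw [hdet]; exact one_ne_zero)
        have h1 : (1 : ℤ) ≤ (γ 1 1) ^ 2 := by
          have := sq_pos_of_ne_zero hd0
          omega
        rw [hc]
        have h2 : (1 : ℝ) ≤ (γ 1 1 : ℝ) ^ 2 := by exact_mod_cast h1
        simpa using h2
      · have h1 : (1 : ℤ) ≤ (γ 1 0) ^ 2 := by
          have := sq_pos_of_ne_zero hc
          omega
        have h2 : (1 : ℝ) ≤ (γ 1 0 : ℝ) ^ 2 := by exact_mod_cast h1
        have h3 : 1 ≤ τ.im ^ 2 := one_le_pow₀ hy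
        have h4 : 1 ≤ ((γ 1 0 : ℝ) * τ.im) ^ 2 := by
          rw [mul_pow]
          exact one_le_mul_of_one_le_of_one_le h2 h3
        nlinarith [sq_nonneg ((γ 1 0 : ℝ) * τ.re + γ 1 1)]
    nlinarith [norm_nonneg j]
  have hj2 : ‖j‖ ≤ (5 * |(γ 1 0 : ℝ)| + |(γ 1 1 : ℝ)|) * τ.im := by
    have h1 : ‖j‖ ≤ |(γ 1 0 : ℝ)| * ‖(τ : ℂ)‖ + |(γ 1 1 : ℝ)| := by
      rw [hd]
      refine (norm_add_le _ _).trans ?_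
      rw [norm_mul, Complex.norm_intCast, Complex.norm_intCast]
    have h2 : ‖(τ : ℂ)‖ ≤ 4 + τ.im := by
      refine (Complex.norm_le_abs_re_add_abs_im _).trans ?_
      have : |(τ : ℂ).im| = τ.im := abs_of_pos hy0
      rw [this]
      gcongr
      exact hx
    calc ‖j‖ ≤ |(γ 1 0 : ℝ)| * (4 * τ.im + τ.im) + |(γ 1 1 : ℝ)| * τ.im := by
          refine h1.trans ?_
          have := abs_nonneg (γ 1 1 : ℝ)
          gcongr ?_ + ?_
          · gcongr
            linarith
          · nlinarith
      _ = _ := by ring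
  have him : (γ • τ).im = τ.im / ‖j‖ ^ 2 := by
    rw [← Complex.normSq_eq_norm_sq]
    exact ModularGroup.im_smul_eq_div_normSq γ τ
  rw [SL_slash_apply, norm_mul, _root_.zpow_neg_one, norm_inv]
  have h5 := hC (γ • τ)
  rw [him] at h5
  have hj0 : 0 < ‖j‖ := by linarith
  calc _ ≤ C * (1 + 1 / (τ.im / ‖j‖ ^ 2)) * ‖j‖⁻¹ := by gcongr
    _ = C * (1 / ‖j‖ + ‖j‖ / τ.im) := by field_simp
    _ ≤ C * (1 + (5 * |(γ 1 0 : ℝ)| + |(γ 1 1 : ℝ)|)) := by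
      gcongr
      · exact (div_le_one hj0).2 hj1
      · rwa [div_le_iff₀ hy0]

theorem isBoundedAtImInfty_thetaSqFun_slash (γ : SpecialLinearGroup (Fin 2) ℤ) :
    UpperHalfPlane.IsBoundedAtImInfty (thetaSqFun ∣[(1 : ℤ)] γ) := by
  obtain ⟨M, hM⟩ := thetaSqFun_slash_bounded_strip γ
  rw [UpperHalfPlane.isBoundedAtImInfty_iff]
  refine ⟨M, 1, fun τ hτ => ?_⟩
  -- Translation by `4k` moves the real part into [0, 4).
  set k : ℤ := -⌊τ.re / 4⌋ with hk
  set w : ℍ := ModularGroup.T ^ (4 * k) • τ with hw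
  have hwc : (w : ℂ) = τ + 4 * k := by
    rw [hw, UpperHalfPlane.modular_T_zpow_smul, UpperHalfPlane.coe_vadd]
    push_cast
    ring
  have hre : w.re = τ.re + 4 * k := by
    have := congrArg Complex.re hwc
    simpa using this
  have him : w.im = τ.im := by
    have := congrArg Complex.im hwc
    simpa using this
  have h1 := hM w (by rw [him]; exact hτ) (by
    rw [hre, hk, abs_le]
    have h2 := Int.floor_le (τ.re / 4)
    have h3 := Int.lt_floor_add_one (τ.re / 4)
    push_cast
    constructor <;> linarith)
  have h2 := congrFun (thetaSqFun_slash_slash_T_zpow γ k) τ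
  rw [slash_action_eq'_iff (γ := ModularGroup.T ^ (4 * k))] at h2
  rw [← hw] at h2
  rw [h2] at h1
  simpa [ModularGroup.coe_T_zpow] using h1

theorem differentiableOn_thetaSq : DifferentiableOn ℂ thetaSq {z | 0 < z.im} := by
  intro z hz
  refine DifferentiableAt.differentiableWithinAt ?_
  have h := differentiableAt_jacobiTheta (two_mul_im_pos hz)
  have h2 : DifferentiableAt ℂ (fun w : ℂ => jacobiTheta (2 * w)) z :=
    h.comp z (by fun_prop : DifferentiableAt ℂ (fun w : ℂ => 2 * w) z)
  exact h2.pow 2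

/-- `θ²` as a modular form of weight `1` on `Γ₁(4)`. -/
noncomputable def thetaSqForm :
    ModularForm ((Gamma1 4).map (Matrix.SpecialLinearGroup.mapGL ℝ)) 1 where
  toFun := thetaSqFun
  slash_action_eq' := by
    rintro _ ⟨γ, hγ, rfl⟩
    exact thetaSqFun_slash_of_mem_Gamma1 hγ
  holo' := by
    rw [UpperHalfPlane.mdifferentiable_iff]
    refine differentiableOn_thetaSq.congr fun z hz => ?_
    simp only [Function.comp]
    rw [UpperHalfPlane.ofComplex_apply_of_im_pos hz]
    rfl
  bdd_at_cusps' := by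
    intro c hc
    -- Every cusp of the subgroup is a cusp of SL₂(ℤ), where boundedness is tested at infinity on
    -- all slashes by SL₂(ℤ).
    have hc' : IsCusp c (Matrix.SpecialLinearGroup.mapGL (n := Fin 2) (R := ℤ) ℝ).range :=
      hc.mono (Subgroup.map_le_range (Matrix.SpecialLinearGroup.mapGL ℝ) (Gamma1 4))
    rw [OnePoint.isBoundedAt_iff_forall_SL2Z hc']
    exact fun γ _ => isBoundedAtImInfty_thetaSqFun_slash γ

end CycProd

/-! ### The main theorem. -/

theorem mainTheorem3 :
    -- Ramanujan's formula
    (∀ n : ℕ, 1 ≤ n →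
      Filter.Tendsto
        (fun N : ℕ => (π : ℂ) * ∑ i ∈ Finset.range N,
          (-1 : ℂ) ^ i * CycProd.ramanujanSum (2 * i + 1) n / (2 * i + 1))
        Filter.atTop (𝓝 (CycProd.r2 n : ℂ))) ∧
    -- the product identity and the logarithmic derivative
    (∃ P : ℂ → ℂ, DifferentiableOn ℂ P (Metric.ball 0 1) ∧
      (∀ z ∈ Metric.ball (0 : ℂ) 1,
        P z ≠ 0 ∧
        Filter.Tendsto
          (fun N : ℕ => ∏ i ∈ Finset.range N,
            (1 - z ^ (4 * i + 3)) ^ (4 / (4 * i + 3) : ℂ) /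
              (1 - z ^ (4 * i + 1)) ^ (4 / (4 * i + 1) : ℂ))
          Filter.atTop (𝓝 (P z)) ∧
        Filter.Tendsto
          (fun N : ℕ => ∏ i ∈ Finset.range N,
            CycProd.phiHatPow (4 * i + 3) (π / (4 * i + 3)) z /
              CycProd.phiHatPow (4 * i + 1) (π / (4 * i + 1)) z)
          Filter.atTop (𝓝 (P z)) ∧
        HasSum (fun n : ℕ => (CycProd.r2 (n + 1) : ℂ) * z ^ (n + 1)) (z * logDeriv P z) ∧
        1 + z * logDeriv P z = CycProd.theta z ^ 2) ∧
      -- `1 + z P'/P` at `z = e^{2πiτ}` is a modular form of weight `1` on `Γ₀(4)` with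
      -- the nontrivial character modulo `4`
      (∃ f : ModularForm
          ((CongruenceSubgroup.Gamma1 4).map (Matrix.SpecialLinearGroup.mapGL ℝ)) 1,
        (∀ γ ∈ CongruenceSubgroup.Gamma0 4, ∀ τ : ℍ,
          f (γ • τ) = ((ZMod.χ₄ (γ 1 1 : ZMod 4) : ℤ) : ℂ) *
            ((γ 1 0 : ℂ) * (τ : ℂ) + (γ 1 1 : ℂ)) * f τ) ∧
        ∀ τ : ℍ, f τ = 1 + Complex.exp (2 * π * Complex.I * (τ : ℂ)) *
          logDeriv P (Complex.exp (2 * π * Complex.I * (τ : ℂ))))) ∧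
    -- the identity of logarithms
    (∀ z ∈ Metric.ball (0 : ℂ) 1, ∃ S : ℂ,
      Filter.Tendsto
        (fun N : ℕ => ∑ i ∈ Finset.range N,
          (4 / (4 * i + 3) * Complex.log (1 - z ^ (4 * i + 3)) -
            4 / (4 * i + 1) * Complex.log (1 - z ^ (4 * i + 1))))
        Filter.atTop (𝓝 S) ∧
      Filter.Tendsto
        (fun N : ℕ => ∑ i ∈ Finset.range N,
          (π / (4 * i + 3) * CycProd.logPhiHat (4 * i + 3) z -
            π / (4 * i + 1) * CycProd.logPhiHat (4 * i + 1) z))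
        Filter.atTop (𝓝 S)) ∧
    -- `π/4` as a ratio of two logarithmic series
    (∃ A B : ℂ → ℂ,
      (∀ z ∈ Metric.ball (0 : ℂ) 1,
        Filter.Tendsto
          (fun N : ℕ => ∑ i ∈ Finset.range N,
            (-1 : ℂ) ^ (i + 1) * (Complex.log (1 - z ^ (2 * i + 1)) / (2 * i + 1)))
          Filter.atTop (𝓝 (A z)) ∧
        Filter.Tendsto
          (fun N : ℕ => ∑ i ∈ Finset.range N,
            (-1 : ℂ) ^ (i + 1) * (CycProd.logPhiHat (2 * i + 1) z / (2 * i + 1)))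
          Filter.atTop (𝓝 (B z)) ∧
        A z = (π / 4 : ℂ) * B z ∧
        (B z ≠ 0 → (π / 4 : ℂ) = A z / B z)) ∧
      -- the denominator vanishes at most on a relatively discrete closed subset of the disk
      (∀ᶠ z in Filter.codiscreteWithin (Metric.ball (0 : ℂ) 1), B z ≠ 0)) := by
  have hball : ∀ z ∈ Metric.ball (0 : ℂ) 1, ‖z‖ < 1 := fun z hz => mem_ball_zero_iff.1 hz
  have hπ : (π : ℂ) ≠ 0 := by exact_mod_cast Real.pi_ne_zero
  refine ⟨fun n hn => ?_, ?_, ?_, ?_⟩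
  · have h := (CycProd.tendsto_ramanujanPartialSum (Nat.one_le_iff_ne_zero.1 hn)).const_mul (π : ℂ)
    rwa [mul_div_cancel₀ _ hπ] at h
  · refine ⟨fun z => Complex.exp (CycProd.r2LogSeries z),
      CycProd.differentiableOn_r2LogSeries.cexp, fun z hz => ?_, CycProd.thetaSqForm, ?_, ?_⟩
    · have hz1 := hball z hz
      rw [CycProd.logDeriv_exp_r2LogSeries hz1]
      exact ⟨Complex.exp_ne_zero _, CycProd.tendsto_prod_one_sub_pow hz1,
        CycProd.tendsto_prod_phiHatPow hz1, CycProd.hasSum_mul_deriv_r2LogSeries hz1,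
        CycProd.one_add_mul_deriv_r2LogSeries hz1⟩
    · exact fun γ hγ τ => CycProd.thetaSqFun_smul hγ τ
    · intro τ
      have hz1 : ‖Complex.exp (2 * π * Complex.I * (τ : ℂ))‖ < 1 :=
        τ.norm_exp_two_pi_I_lt_one
      rw [CycProd.logDeriv_exp_r2LogSeries hz1, CycProd.one_add_mul_deriv_r2LogSeries hz1,
        CycProd.theta_exp_sq]
      rfl
  · exact fun z hz => ⟨CycProd.r2LogSeries z, CycProd.tendsto_paired_sum_log (hball z hz),
      CycProd.tendsto_paired_sum_logPhiHat (hball z hz)⟩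
  · refine ⟨fun z => CycProd.r2LogSeries z / 4, fun z => CycProd.r2LogSeries z / π,
      fun z hz => ⟨CycProd.tendsto_sum_log_one_sub_pow (hball z hz),
        CycProd.tendsto_sum_logPhiHat (hball z hz), ?_, fun hB => ?_⟩, ?_⟩
    · field_simp
    · have hS : CycProd.r2LogSeries z ≠ 0 := fun h => hB (by simp [h])
      field_simp
    · filter_upwards [CycProd.eventually_codiscreteWithin_r2LogSeries_ne_zero] with z hz
      exact div_ne_zero hz hπ
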